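/- Fix a finite set $\mathrm{ZFC}^*$ of axioms of $\mathrm{ZFC}$ (arbitrary in what follows). For a cardinal $\kappa$, a \emph{$\kappa$-model} is a transitive set $M$ of size $\kappa$ with $\kappa\in M$, $\langle M,\in\rangle\models\mathrm{ZFC}^*$ and $M^{<\kappa}\subseteq M$. For an ordinal $\theta$, an inaccessible cardinal $\kappa$ is \emph{$\theta$-strongly unfoldable} if for every $\kappa$-model $M$ there are a transitive set $N$ and an elementary embedding $j:M\to N$ with critical point $\kappa$ such that $j(\kappa)\ge\theta$ and $V_\theta\subseteq N$; and $\kappa$ is \emph{strongly unfoldable} if it is $\theta$-strongly unfoldable for every ordinal $\theta$. A cardinal $\kappa$ is \emph{totally indescribable} if it is $\Pi^m_n$-indescribable for all $m,n<\omega$, that is, if for every $m<\omega$, every $R\subseteq V_\kappa$ and every first-order sentence $\sigma$ in the language with $\in$ and a unary predicate, if $\langle V_{\kappa+m},\in,R\rangle\models\sigma$, then $\langle V_{\alpha+m},\in,R\cap V_\alpha\rangle\models\sigma$ for some $\alpha<\kappa$. Theorem. Every strongly unfoldable cardinal $\kappa$ is totally indescribable and a limit of totally indescribable cardinals (for every ordinal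 $\beta<\kappa$ there is a totally indescribable cardinal $\gamma$ with $\beta<\gamma<\kappa$). Indeed, if $\kappa$ is merely $(\kappa+\omega)$-strongly unfoldable, then the set of totally indescribable cardinals below $\kappa$ is a stationary subset of $\kappa$. -/

import Mathlib

universe u

namespace Unfoldable

open FirstOrder FirstOrder.Language

/-! ### The language of set theory and its transitive set models -/

/-- The only non-logical symbol of set theory: a binary relation symbol for membership. -/
inductive SetRel : ℕ → Type
  | mem : SetRel 2

/-- The first-order language of set theory. -/
def setLang : FirstOrder.Language.{0, 0} := ⟨fun _ => Empty, SetRel⟩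

/-- The membership symbol of `setLang`. -/
def memSym : setLang.Relations 2 := SetRel.mem

/-- The elements of a set `M`, as a type. -/
abbrev Elems (M : ZFSet.{u}) : Type (u + 1) := {x : ZFSet.{u} // x ∈ M}

/-- Every set `M` is regarded as the structure `⟨M, ∈⟩`. -/
instance elemsStructure (M : ZFSet.{u}) : setLang.Structure (Elems M) where
  funMap f := Empty.elim f
  RelMap r xs := match r with
    | SetRel.mem => (xs 0).1 ∈ (xs 1).1

/-- The atomic formula `t ∈ s`. -/
def memF {α : Type} {n : ℕ} (t s : setLang.Term (α ⊕ Fin n)) : setLang.BoundedFormula α n :=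
  memSym.boundedFormula₂ t s

/-! ### The axioms of ZFC
Bound variables are numbered by the depth of their quantifier: `&0` is bound by the outermost
quantifier, `&1` by the next one, and so on. -/

/-- Extensionality: `∀ a b, (∀ x, x ∈ a ↔ x ∈ b) → a = b`. -/
def extensionality : setLang.Sentence :=
  ∀' ∀' ((∀' (memF &2 &0 ⇔ memF &2 &1)) ⟹ (&0 =' &1))

/-- Foundation: `∀ a, (∃ x, x ∈ a) → ∃ x, x ∈ a ∧ ∀ y, y ∈ x → y ∉ a`. -/
def foundation : setLang.Sentence :=
  ∀' ((∃' memF &1 &0) ⟹ ∃' (memF &1 &0 ⊓ ∀' (memF &2 &1 ⟹ ∼(memF &2 &0))))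

/-- Pairing: `∀ a b, ∃ c, ∀ x, x ∈ c ↔ x = a ∨ x = b`. -/
def pairing : setLang.Sentence :=
  ∀' ∀' ∃' ∀' (memF &3 &2 ⇔ ((&3 =' &0) ⊔ (&3 =' &1)))

/-- Union: `∀ a, ∃ b, ∀ x, x ∈ b ↔ ∃ y, y ∈ a ∧ x ∈ y`. -/
def union : setLang.Sentence :=
  ∀' ∃' ∀' (memF &2 &1 ⇔ ∃' (memF &3 &0 ⊓ memF &2 &3))

/-- Power set: `∀ a, ∃ b, ∀ x, x ∈ b ↔ ∀ y, y ∈ x → y ∈ a`. -/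
def powerSet : setLang.Sentence :=
  ∀' ∃' ∀' (memF &2 &1 ⇔ ∀' (memF &3 &2 ⟹ memF &3 &0))

/-- Infinity: `∃ w, (∃ e, e ∈ w ∧ ∀ z, z ∉ e) ∧
∀ x, x ∈ w → ∃ y, y ∈ w ∧ ∀ z, z ∈ y ↔ z ∈ x ∨ z = x`. -/
def infinity : setLang.Sentence :=
  ∃' ((∃' (memF &1 &0 ⊓ ∀' ∼(memF &2 &1))) ⊓
    ∀' (memF &1 &0 ⟹ ∃' (memF &2 &0 ⊓ ∀' (memF &3 &2 ⇔ (memF &3 &1 ⊔ (&3 =' &1))))))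

/-- Choice: every set `a` of nonempty pairwise disjoint sets has a transversal `c`:
`∀ a, (∀ x, x ∈ a → ∃ y, y ∈ x) ∧ (∀ x y, x ∈ a ∧ y ∈ a → (∃ z, z ∈ x ∧ z ∈ y) → x = y) →
∃ c, ∀ x, x ∈ a → ∃ y, ∀ z, z ∈ x ∧ z ∈ c ↔ z = y`. -/
def choice : setLang.Sentence :=
  ∀' (((∀' (memF &1 &0 ⟹ ∃' memF &2 &1)) ⊓
      ∀' ∀' ((memF &1 &0 ⊓ memF &2 &0) ⟹ (∃' (memF &3 &1 ⊓ memF &3 &2)) ⟹ (&1 =' &2))) ⟹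
    ∃' ∀' (memF &2 &0 ⟹ ∃' ∀' ((memF &4 &2 ⊓ memF &4 &1) ⇔ (&4 =' &3))))

/-- The instance `∀ p₀ … pₙ₋₁ a, ∃ b, ∀ x, x ∈ b ↔ x ∈ a ∧ φ(p₀, …, pₙ₋₁, x)` of the separation
scheme. -/
def separation {n : ℕ} (φ : setLang.Formula (Fin (n + 1))) : setLang.Sentence :=
  let a : Fin (n + 3) := ⟨n, by omega⟩
  let b : Fin (n + 3) := ⟨n + 1, by omega⟩
  let x : Fin (n + 3) := ⟨n + 2, by omega⟩
  let φ' : setLang.BoundedFormula Empty (n + 3) :=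
    BoundedFormula.relabel (k := 0)
      (fun i => Sum.inr (Fin.lastCases x (fun j : Fin n => ⟨j, by omega⟩) i)) φ
  BoundedFormula.alls (n := n + 1) (∃' ∀' (memF &x &b ⇔ (memF &x &a ⊓ φ')))

/-- The instance `∀ p₀ … pₙ₋₁ a, (∀ x, x ∈ a → ∀ y z, φ(p, x, y) ∧ φ(p, x, z) → y = z) →
∃ b, ∀ y, y ∈ b ↔ ∃ x, x ∈ a ∧ φ(p, x, y)` of the replacement scheme. -/
def replacement {n : ℕ} (φ : setLang.Formula (Fin (n + 2))) : setLang.Sentence :=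
  let sub {k : ℕ} (h : n ≤ k) (x y : Fin k) : setLang.BoundedFormula Empty k :=
    BoundedFormula.relabel (k := 0)
      (fun i => Sum.inr (Fin.lastCases y
        (fun i' => Fin.lastCases x (fun j : Fin n => ⟨j, by omega⟩) i') i)) φ
  let functional : setLang.BoundedFormula Empty (n + 1) :=
    let a : Fin (n + 4) := ⟨n, by omega⟩
    let x : Fin (n + 4) := ⟨n + 1, by omega⟩
    let y : Fin (n + 4) := ⟨n + 2, by omega⟩
    let z : Fin (n + 4) := ⟨n + 3, by omega⟩
    ∀' ∀' ∀' (memF &x &a ⟹ (sub (by omega) x y ⊓ sub (by omega) x z) ⟹ (&y =' &z))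
  let image : setLang.BoundedFormula Empty (n + 1) :=
    let a : Fin (n + 4) := ⟨n, by omega⟩
    let b : Fin (n + 3) := ⟨n + 1, by omega⟩
    let y : Fin (n + 3) := ⟨n + 2, by omega⟩
    let y' : Fin (n + 4) := ⟨n + 2, by omega⟩
    let x : Fin (n + 4) := ⟨n + 3, by omega⟩
    ∃' ∀' (memF &y &b ⇔ ∃' (memF &x &a ⊓ sub (by omega) x y'))
  BoundedFormula.alls (n := n + 1) (functional ⟹ image)

/-- The axioms of Zermelo–Fraenkel set theory with choice. -/
def ZFC : setLang.Theory :=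
  {extensionality, foundation, pairing, union, powerSet, infinity, choice} ∪
    {σ | ∃ (n : ℕ) (φ : setLang.Formula (Fin (n + 1))), σ = separation φ} ∪
    {σ | ∃ (n : ℕ) (φ : setLang.Formula (Fin (n + 2))), σ = replacement φ}

/-! ### Strongly unfoldable cardinals -/

/-- `M` is a `κ`-model of the theory `T`: a transitive set of size `κ` with `κ ∈ M`, `M ⊨ T` and
`M^{<κ} ⊆ M`. -/
structure IsKappaModel (T : setLang.Theory) (κ : Cardinal.{u}) (M : ZFSet.{u}) : Prop where
  isTransitive : M.IsTransitive
  card_eq : M.card = κ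
  mem : κ.ord.toZFSet ∈ M
  models : ∀ σ ∈ T, Sentence.Realize (Elems M) σ
  closed : ∀ α < κ.ord, ZFSet.funs α.toZFSet M ⊆ M

/-- `δ` is the critical point of `j : M → N`, i.e. the least ordinal of `M` that is moved. -/
def IsCriticalPoint {M N : ZFSet.{u}} (j : Elems M ↪ₑ[setLang] Elems N) (δ : Ordinal.{u}) : Prop :=
  (∃ h : δ.toZFSet ∈ M, (j ⟨δ.toZFSet, h⟩).1 ≠ δ.toZFSet) ∧
    ∀ α < δ, ∀ h : α.toZFSet ∈ M, (j ⟨α.toZFSet, h⟩).1 = α.toZFSet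

/-- The (inaccessible) cardinal `κ` is `θ`-strongly unfoldable, with `T` as the fragment of set
theory that `κ`-models are required to satisfy: every `κ`-model `M` has an elementary embedding
`j : M → N` into a transitive set `N` with critical point `κ`, `j(κ) ≥ θ` and `V_θ ⊆ N`. -/
def IsStronglyUnfoldableTo (T : setLang.Theory) (κ : Cardinal.{u}) (θ : Ordinal.{u}) : Prop :=
  κ.IsInaccessible ∧ ∀ (M : ZFSet.{u}) (hM : IsKappaModel T κ M),
    ∃ (N : ZFSet.{u}) (j : Elems M ↪ₑ[setLang] Elems N), N.IsTransitive ∧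
      IsCriticalPoint j κ.ord ∧ θ.toZFSet ⊆ (j ⟨κ.ord.toZFSet, hM.mem⟩).1 ∧
      ZFSet.vonNeumann θ ⊆ N

/-- `κ` is strongly unfoldable: `θ`-strongly unfoldable for every ordinal `θ`. -/
def IsStronglyUnfoldable (T : setLang.Theory) (κ : Cardinal.{u}) : Prop :=
  ∀ θ : Ordinal.{u}, IsStronglyUnfoldableTo T κ θ

/-! ### Totally indescribable cardinals -/

/-- A binary relation symbol for membership and a unary predicate symbol. -/
inductive SetPredRel : ℕ → Type
  | mem : SetPredRel 2
  | pred : SetPredRel 1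

/-- The language of set theory with an additional unary predicate symbol. -/
def setPredLang : FirstOrder.Language.{0, 0} := ⟨fun _ => Empty, SetPredRel⟩

/-- The structure `⟨A, ∈, R ∩ A⟩`. -/
@[reducible] def predStructure (A R : ZFSet.{u}) : setPredLang.Structure (Elems A) where
  funMap f := Empty.elim f
  RelMap r xs := match r with
    | SetPredRel.mem => (xs 0).1 ∈ (xs 1).1
    | SetPredRel.pred => (xs 0).1 ∈ R

/-- `⟨A, ∈, R ∩ A⟩ ⊨ σ`. -/
def PredSat (A R : ZFSet.{u}) (σ : setPredLang.Sentence) : Prop :=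
  @Sentence.Realize setPredLang (Elems A) (predStructure A R) σ

/-- `κ` is totally indescribable, i.e. `Π^m_n`-indescribable for all `m` and `n`: whenever
`R ⊆ V_κ` and a sentence `σ` (of any quantifier complexity `Π_n`) holds in `⟨V_{κ+m}, ∈, R⟩`,
there is `α < κ` such that `σ` holds in `⟨V_{α+m}, ∈, R ∩ V_α⟩`. -/
def IsTotallyIndescribable (κ : Cardinal.{u}) : Prop :=
  ∀ (m : ℕ) (R : ZFSet.{u}) (σ : setPredLang.Sentence), R ⊆ ZFSet.vonNeumann κ.ord →
    PredSat (ZFSet.vonNeumann (κ.ord + m)) R σ →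
    ∃ α < κ.ord, PredSat (ZFSet.vonNeumann (α + m)) (R ∩ ZFSet.vonNeumann α) σ

end Unfoldable

/-! Let `κ` be `(κ + ω)`-strongly unfoldable. Inaccessibility provides `κ`-models `M` that contain
`V_κ` and any finitely many subsets of it (`exists_isKappaModel`). The embedding `j : M → N` fixes
`V_κ` pointwise (`map_eq_self`), and for `C` club in `κ` the level `V_κ` belongs to `j {V_γ | γ ∈
C}` (`vonNeumann_mem_map_levels`). As `V_{κ+ω} ⊆ N`, truth in `V_{κ+m}` is evaluated correctly in
`N` (`sat_iff`).

Indescribability: if `σ` with predicate `R` reflects to no `α < κ`, then `M` sees that `σ` fails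
over every `V_α` with predicate `R ∩ V_α`. By elementarity `N` sees it fail over `V_κ` with
predicate `j R ∩ V_κ = R`, although `σ` holds in `V_{κ+m}`.

Stationarity: if a club `C` of cardinals avoids the totally indescribable ones, choose for each `γ ∈
C` a counterexample, namely a natural number coding `(m, σ)` and a predicate `R γ ⊆ V_γ`. By
elementarity `N` has such a counterexample for `V_κ`. Its code is a genuine natural number because
`j` fixes `ω`, and `N` evaluates it correctly, so `κ` itself is not totally indescribable, contrary
to the first argument.

Elementarity is applied to properties defined by one formula in all transitive sets (`UDef`), so
transitivity of `M` and `N` suffices to read the formulas. -/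

namespace Unfoldable

/-! ### Closing off a set of size `κ` under operations on small subsets. -/

open Cardinal Set

/-- A regular strong limit `κ` has only `κ` subsets of size less than `κ`; the embedding `e` carries
this count over to `Y`. -/
theorem mk_small_subsets_le {α : Type v} {κ : Cardinal.{v}} (hκ : κ.IsInaccessible) {Y : Set α}
    (hY : #Y ≤ κ) : #{s : Set α // s ⊆ Y ∧ #s < κ} ≤ κ := by
  have hι : #κ.ord.ToType = κ := by simp
  obtain ⟨e⟩ : Nonempty (Y ↪ κ.ord.ToType) := by
    rw [← Cardinal.le_def, hι]; exact hY
  have h1 := mk_subset_mk_lt_cof (α := κ.ord.ToType) (by rw [hι]; exact hκ.isStrongPrelimit)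
  rw [hι, hκ.isRegular.cof_ord] at h1
  conv_rhs => rw [← h1]
  refine mk_le_of_injective (f := fun s => ⟨e '' (Subtype.val ⁻¹' s.1), ?_⟩) ?_
  · refine mk_image_le.trans_lt (lt_of_le_of_lt ?_ s.2.2)
    exact mk_preimage_of_injective _ _ Subtype.val_injective
  · rintro ⟨s, hs⟩ ⟨t, ht⟩ h
    have h2 := e.injective.image_injective (Subtype.mk.inj h)
    rw [Set.preimage_eq_preimage' (by simpa using hs.1) (by simpa using ht.1)] at h2
    exact Subtype.ext h2

theorem mk_iUnion_le_of_le {α ι : Type v} {κ : Cardinal.{v}} (hκ : ℵ₀ ≤ κ) (hι : #ι ≤ κ)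
    {f : ι → Set α} (hf : ∀ i, #(f i) ≤ κ) : #(⋃ i, f i) ≤ κ :=
  calc #(⋃ i, f i) ≤ #ι * ⨆ i, #(f i) := mk_iUnion_le f
    _ ≤ κ * κ := mul_le_mul' hι (ciSup_le' hf)
    _ = κ := mul_eq_self hκ

/-- For inaccessible `κ`, every set of size at most `κ` is contained in a set of size at most `κ`
that is closed under a given operation on subsets of size less than `κ`. -/
theorem exists_closed_superset {α : Type v} {κ : Cardinal.{v}} (hκ : κ.IsInaccessible)
    {A : Set α} (hA : #A ≤ κ) {F : Set α → Set α} (hF : ∀ s : Set α, #s < κ → #(F s) ≤ κ) :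
    ∃ X : Set α, A ⊆ X ∧ #X ≤ κ ∧ ∀ s ⊆ X, #s < κ → F s ⊆ X := by
  let ι := κ.ord.ToType
  have hι : #ι = κ := by simp [ι]
  have hcof : Order.cof ι = κ := by rw [Ordinal.cof_toType, hκ.isRegular.cof_ord]
  -- Stage `i` adds to `A` the values of `F` at small subsets of earlier stages. The stages increase
  -- with `i` without containing each other by definition, since the union over `Iio i` grows.
  let step : (i : ι) → ((j : ι) → j < i → Set α) → Set α := fun i Y =>
    A ∪ ⋃ j : Iio i, ⋃ s : {s : Set α // s ⊆ Y j.1 j.2 ∧ #s < κ}, F s.1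
  let Y : ι → Set α := WellFounded.fix (r := (· < ·)) wellFounded_lt step
  have Yeq (i : ι) : Y i = A ∪ ⋃ j : Iio i, ⋃ s : {s : Set α // s ⊆ Y j ∧ #s < κ}, F s.1 :=
    WellFounded.fix_eq _ _ _
  have Ycard (i : ι) : #(Y i) ≤ κ := by
    induction i using WellFoundedLT.induction with
    | ind i ih =>
      rw [Yeq]
      refine (mk_union_le _ _).trans ((add_le_add hA ?_).trans (add_eq_self hκ.aleph0_lt.le).le)
      refine mk_iUnion_le_of_le hκ.aleph0_lt.le ((mk_set_le _).trans hι.le) fun j => ?_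
      exact mk_iUnion_le_of_le hκ.aleph0_lt.le (mk_small_subsets_le hκ (ih j.1 j.2))
        fun s => hF s.1 s.2.2
  have Ymono {i j : ι} (h : i ≤ j) : Y i ⊆ Y j := by
    rw [Yeq i, Yeq j]
    refine union_subset_union_right _ (iUnion_subset fun k => ?_)
    exact subset_iUnion_of_subset ⟨k.1, k.2.trans_le h⟩ subset_rfl
  have hne : Nonempty ι := by
    rw [← mk_ne_zero_iff, hι]; exact hκ.ne_zero
  have hnomax : NoMaxOrder ι := by
    have h1 : 1 < Order.cof ι := by rw [hcof]; exact one_lt_aleph0.trans hκ.aleph0_lt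
    have := Order.one_lt_cof_iff.1 h1
    exact NoTopOrder.to_noMaxOrder ι
  refine ⟨⋃ i, Y i, ?_, ?_, ?_⟩
  · refine subset_iUnion_of_subset (Classical.arbitrary ι) ?_
    rw [Yeq]; exact subset_union_left
  · exact mk_iUnion_le_of_le hκ.aleph0_lt.le hι.le Ycard
  · intro s hs hsκ
    choose f hf using fun x : s => mem_iUnion.1 (hs x.2)
    -- By regularity the stages at which the fewer than `κ` elements of `s` appear are bounded by
    -- some `i`; any later stage contains `F s`.
    have hb : ¬ IsCofinal (range f) := fun h =>
      ((Order.cof_le h).trans mk_range_le).not_gt (by rwa [hcof])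
    obtain ⟨i, hi⟩ : ∃ i, ∀ x, f x < i := by
      simpa [IsCofinal] using hb
    obtain ⟨j, hj⟩ := exists_gt i
    refine subset_iUnion_of_subset j ?_
    rw [Yeq j]
    refine subset_union_of_subset_right (subset_iUnion_of_subset ⟨i, hj⟩ ?_) _
    exact subset_iUnion (fun s : {s : Set α // s ⊆ Y i ∧ #s < κ} => F s.1)
      ⟨s, fun x hx => Ymono (hi ⟨x, hx⟩).le (hf ⟨x, hx⟩), hsκ⟩

end Unfoldable
-- The universe of sets satisfies ZFC.
namespace Unfoldable

open FirstOrder FirstOrder.Language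

/-- The universe of all sets as a structure for the language of set theory. -/
instance universeStructure : setLang.Structure ZFSet.{u} where
  funMap f := Empty.elim f
  RelMap r xs := match r with
    | SetRel.mem => xs 0 ∈ xs 1

theorem realize_memF_universe {α : Type} {n : ℕ} (t s : setLang.Term (α ⊕ Fin n))
    (v : α → ZFSet.{u}) (xs : Fin n → ZFSet.{u}) :
    (memF t s).Realize v xs ↔
      t.realize (Sum.elim v xs) ∈ s.realize (Sum.elim v xs) := by
  rw [memF, BoundedFormula.realize_rel₂]
  rfl

theorem realize_bvar {L : Language} {M : Type*} [L.Structure M] {α : Type} {n : ℕ} (x : Fin n)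
    (v : α → M) (xs : Fin n → M) :
    (&x : L.Term (α ⊕ Fin n)).realize (Sum.elim v xs) = xs x := rfl

theorem realize_extensionality : Sentence.Realize ZFSet.{u} extensionality := by
  simp only [Sentence.Realize, extensionality, Formula.Realize, BoundedFormula.realize_all,
    BoundedFormula.realize_imp, BoundedFormula.realize_iff, realize_memF_universe,
    BoundedFormula.realize_bdEqual, Term.realize_var, Sum.elim_inr, Function.comp]
  intro a b h
  exact ZFSet.ext h

theorem realize_foundation : Sentence.Realize ZFSet.{u} foundation := by
  simp [Sentence.Realize, foundation, Formula.Realize, realize_memF_universe, Fin.snoc]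
  intro a x hx
  obtain ⟨y, hy, h⟩ := ZFSet.regularity a (fun h => by simp [h] at hx)
  refine ⟨y, hy, fun z hz hza => ?_⟩
  have : z ∈ a ∩ y := ZFSet.mem_inter.2 ⟨hza, hz⟩
  simp [h] at this

theorem realize_pairing : Sentence.Realize ZFSet.{u} pairing := by
  simp [Sentence.Realize, pairing, Formula.Realize, realize_memF_universe, Fin.snoc]
  exact fun a b => ⟨{a, b}, by simp⟩

theorem realize_union : Sentence.Realize ZFSet.{u} union := by
  simp [Sentence.Realize, union, Formula.Realize, realize_memF_universe, Fin.snoc]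
  exact fun a => ⟨ZFSet.sUnion a, by simp⟩

theorem realize_powerSet : Sentence.Realize ZFSet.{u} powerSet := by
  simp [Sentence.Realize, powerSet, Formula.Realize, realize_memF_universe, Fin.snoc]
  exact fun a => ⟨ZFSet.powerset a, by simp [ZFSet.subset_def]⟩

theorem realize_infinity : Sentence.Realize ZFSet.{u} infinity := by
  simp [Sentence.Realize, infinity, Formula.Realize, realize_memF_universe, Fin.snoc]
  refine ⟨ZFSet.omega, ⟨∅, ZFSet.omega_zero, by simp⟩, fun x hx => ⟨_, ZFSet.omega_succ hx, ?_⟩⟩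
  simp [or_comm]

theorem realize_choice : Sentence.Realize ZFSet.{u} choice := by
  simp [Sentence.Realize, choice, Formula.Realize, realize_memF_universe, Fin.snoc]
  intro a hne hdisj
  choose! f hf using hne
  refine ⟨(ZFSet.sUnion a).sep fun y => ∃ x ∈ a, y = f x, fun x hx => ⟨f x, fun z => ?_⟩⟩
  simp only [ZFSet.mem_sep, ZFSet.mem_sUnion]
  constructor
  · rintro ⟨hzx, -, y, hy, rfl⟩
    rw [hdisj y x hy hx (f y) (hf y hy) hzx]
  · rintro rfl
    exact ⟨hf x hx, ⟨x, hx, hf x hx⟩, x, hx, rfl⟩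

theorem realize_relabel_bvar {L : Language} {M : Type*} [L.Structure M] {β : Type} {k : ℕ}
    (φ : L.Formula β) (g : β → Fin k) (zs : Fin k → M) (v : β → M) (h : ∀ i, zs (g i) = v i) :
    (BoundedFormula.relabel (n := k) (k := 0) (fun i => Sum.inr (g i)) φ).Realize
      (default : Empty → M) zs ↔ φ.Realize v := by
  rw [BoundedFormula.realize_relabel, Formula.Realize]
  exact iff_of_eq (congrArg₂ (fun w w' => BoundedFormula.Realize φ w w') (funext h)
    (Subsingleton.elim _ _))

theorem realize_separation {n : ℕ} (φ : setLang.Formula (Fin (n + 1))) :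
    Sentence.Realize ZFSet.{u} (separation φ) := by
  rw [separation, Sentence.Realize, BoundedFormula.realize_alls]
  intro xs
  simp only [BoundedFormula.realize_ex, BoundedFormula.realize_all, BoundedFormula.realize_iff,
    BoundedFormula.realize_inf, realize_memF_universe, realize_bvar]
  refine ⟨(xs (Fin.last n)).sep fun x =>
    φ.Realize (Fin.snoc (α := fun _ => ZFSet) (fun j : Fin n => xs j.castSucc) x), fun x => ?_⟩
  refine Iff.trans ?_ (and_congr_right fun _ => (realize_relabel_bvar φ _ _
    (Fin.snoc (α := fun _ => ZFSet) (fun j : Fin n => xs j.castSucc) x) fun i => ?_).symm)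
  · simp [Fin.snoc]
    exact fun _ => Iff.rfl
  · refine Fin.lastCases ?_ (fun j => ?_) i
    · simp [Fin.snoc]
    · have := j.2
      simp [Fin.snoc, show j.1 < n + 1 by omega, show j.1 < n + 2 by omega]
      rfl

theorem realize_replacement {n : ℕ} (φ : setLang.Formula (Fin (n + 2))) :
    Sentence.Realize ZFSet.{u} (replacement φ) := by
  rw [replacement, Sentence.Realize, BoundedFormula.realize_alls]
  intro xs
  simp only [BoundedFormula.realize_imp, BoundedFormula.realize_ex, BoundedFormula.realize_all,
    BoundedFormula.realize_iff, BoundedFormula.realize_inf, realize_memF_universe, realize_bvar,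
    BoundedFormula.realize_bdEqual]
  intro hfun
  let v (x y : ZFSet.{u}) : Fin (n + 2) → ZFSet.{u} := Fin.snoc (α := fun _ => ZFSet)
    (Fin.snoc (α := fun _ => ZFSet) (fun j : Fin n => xs j.castSucc) x) y
  have hv {k : ℕ} (hk : n ≤ k) (x y : Fin k) (zs : Fin k → ZFSet.{u})
      (hzs : ∀ j : Fin n, zs ⟨j, by omega⟩ = xs j.castSucc) (i : Fin (n + 2)) :
      zs (Fin.lastCases (motive := fun _ => Fin k) y (fun i' => Fin.lastCases x
          (fun j : Fin n => ⟨j, by omega⟩) i') i) = v (zs x) (zs y) i := by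
    refine Fin.lastCases ?_ (fun i => Fin.lastCases ?_ (fun j => ?_) i) i
    · simp [v]
    · simp [v]
    · simpa [v] using hzs j
  have hfun' : ∀ x ∈ xs (Fin.last n), ∀ y z, φ.Realize (v x y) → φ.Realize (v x z) → y = z := by
    intro x hx y z hy hz
    have := hfun x y z ?_ ⟨(realize_relabel_bvar φ _ _ (v x y) fun i => ?_).2 hy,
      (realize_relabel_bvar φ _ _ (v x z) fun i => ?_).2 hz⟩
    · simpa [Fin.snoc] using this
    · simp [Fin.snoc]
      exact hx
    · refine (hv (by omega) _ _ _ (fun j => ?_) i).trans ?_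
      · have := j.2
        simp [Fin.snoc, show j.1 < n + 1 by omega, show j.1 < n + 2 by omega,
          show j.1 < n + 3 by omega]
        rfl
      · simp [Fin.snoc]
    · refine (hv (by omega) _ _ _ (fun j => ?_) i).trans ?_
      · have := j.2
        simp [Fin.snoc, show j.1 < n + 1 by omega, show j.1 < n + 2 by omega,
          show j.1 < n + 3 by omega]
        rfl
      · simp [Fin.snoc]
  choose! f hf using fun x (h : ∃ y, φ.Realize (v x y)) => h
  -- Only the `x` that have an image are kept, so the default values of `f` do not enter the range.
  let a := (xs (Fin.last n)).sep fun x => ∃ y, φ.Realize (v x y)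
  refine ⟨ZFSet.range fun x : a => f x.1, fun y => ?_⟩
  have key (x b : ZFSet.{u}) : BoundedFormula.Realize _ _ _ ↔ φ.Realize (v x y) :=
    realize_relabel_bvar φ _ (Fin.snoc (α := fun _ => ZFSet) (Fin.snoc (α := fun _ => ZFSet)
      (Fin.snoc (α := fun _ => ZFSet) xs b) y) x) (v x y) fun i => by
        refine (hv (by omega) ⟨n + 3, by omega⟩ ⟨n + 2, by omega⟩ _ (fun j => ?_) i).trans ?_
        · have := j.2
          simp [Fin.snoc, show j.1 < n + 1 by omega, show j.1 < n + 2 by omega,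
            show j.1 < n + 3 by omega]
          rfl
        · simp [Fin.snoc]
  refine Iff.trans ?_ (exists_congr fun x => and_congr_right fun _ => (key x _).symm)
  simp [Fin.snoc, a]
  constructor
  · rintro ⟨x, ⟨hx, y', hy'⟩, rfl⟩
    exact ⟨x, hx, hf x ⟨y', hy'⟩⟩
  · rintro ⟨x, hx, hxy⟩
    exact ⟨x, ⟨hx, y, hxy⟩, hfun' x hx _ _ (hf x ⟨y, hxy⟩) hxy⟩

/-- The universe of all sets is a model of ZFC. -/
theorem universe_models_ZFC {σ : setLang.Sentence} (hσ : σ ∈ ZFC) :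
    Sentence.Realize ZFSet.{u} σ := by
  rcases hσ with (h | ⟨n, φ, rfl⟩) | ⟨n, φ, rfl⟩
  · simp only [Set.mem_insert_iff, Set.mem_singleton_iff] at h
    rcases h with rfl | rfl | rfl | rfl | rfl | rfl | rfl
    exacts [realize_extensionality, realize_foundation, realize_pairing, realize_union,
      realize_powerSet, realize_infinity, realize_choice]
  · exact realize_separation φ
  · exact realize_replacement φ

end Unfoldable
-- Construction of `κ`-models.
namespace Unfoldable

open FirstOrder FirstOrder.Language Cardinal

instance countable_setLang_symbols : Countable setLang.Symbols := by
  have h1 (n : ℕ) : Countable (setLang.Functions n) := inferInstanceAs (Countable Empty)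
  have h2 (n : ℕ) : Subsingleton (setLang.Relations n) := ⟨by rintro ⟨⟩ ⟨⟩; rfl⟩
  exact inferInstanceAs (Countable ((Σ n, setLang.Functions n) ⊕ Σ n, setLang.Relations n))

theorem isInaccessible_lift {κ : Cardinal.{u}} (hκ : κ.IsInaccessible) :
    (lift.{v} κ).IsInaccessible := by
  refine isInaccessible_def.2 ⟨by simpa using hκ.aleph0_lt, hκ.isRegular.lift, ?_, ?_⟩
  · simpa using hκ.ne_zero
  · intro x hx
    obtain ⟨y, hy, rfl⟩ := lt_lift_iff.1 hx
    rw [← lift_two_power]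
    exact lift_lt.2 (hκ.isStrongPrelimit hy)

theorem card_range_coe_le (s : ZFSet.{u}) (f : s → ZFSet.{u}) :
    (ZFSet.range f).card ≤ s.card := by
  have := ZFSet.lift_card_range_le.{u + 1, u} (f := f)
  rw [ZFSet.cardinalMk_coe_sort] at this
  simpa [← lift_umax.{u, u + 1}] using this

/-! ### The Mostowski collapse -/

/-- The Mostowski collapse of the set `X`. -/
noncomputable def collapse (X : Set ZFSet.{u}) : ZFSet.{u} → ZFSet.{u} :=
  ZFSet.mem_wf.fix fun x ih =>
    ZFSet.range fun y : x.sep (· ∈ X) => ih y.1 (ZFSet.mem_sep.1 y.2).1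

section collapse

variable {X : Set ZFSet.{u}}

theorem mem_collapse {x z : ZFSet.{u}} :
    z ∈ collapse X x ↔ ∃ y ∈ x, y ∈ X ∧ collapse X y = z := by
  rw [collapse, WellFounded.fix_eq]
  simp [and_assoc]

theorem collapse_injOn (hext : ∀ x ∈ X, ∀ y ∈ X, (∀ z ∈ X, z ∈ x ↔ z ∈ y) → x = y) :
    Set.InjOn (collapse X) X := by
  intro x hx
  induction x using ZFSet.inductionOn with
  | _ x ih =>
    intro y hy hxy
    refine hext x hx y hy fun z hz => ⟨fun hzx => ?_, fun hzy => ?_⟩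
    · obtain ⟨z', hz'y, hz'X, h⟩ := mem_collapse.1 (hxy ▸ mem_collapse.2 ⟨z, hzx, hz, rfl⟩)
      rwa [ih z hzx hz hz'X h.symm]
    · obtain ⟨z', hz'x, hz'X, h⟩ := mem_collapse.1 (hxy ▸ mem_collapse.2 ⟨z, hzy, hz, rfl⟩)
      rwa [← ih z' hz'x hz'X hz h]

theorem collapse_mem_collapse_iff
    (hext : ∀ x ∈ X, ∀ y ∈ X, (∀ z ∈ X, z ∈ x ↔ z ∈ y) → x = y) {x y : ZFSet.{u}} (hx : x ∈ X) :
    collapse X x ∈ collapse X y ↔ x ∈ y := by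
  refine ⟨fun h => ?_, fun h => mem_collapse.2 ⟨x, h, hx, rfl⟩⟩
  obtain ⟨z, hzy, hz, h⟩ := mem_collapse.1 h
  rwa [← collapse_injOn hext hz hx h]

theorem collapse_eq_self {A : ZFSet.{u}} (hA : A.IsTransitive) (hAX : (A : Set ZFSet.{u}) ⊆ X)
    {x : ZFSet.{u}} (hx : x ∈ A) : collapse X x = x := by
  induction x using ZFSet.inductionOn with
  | _ x ih =>
    ext z
    rw [mem_collapse]
    constructor
    · rintro ⟨y, hy, -, rfl⟩
      rwa [ih y hy (hA.mem_trans hy hx)]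
    · exact fun hz => ⟨z, hz, hAX (hA.mem_trans hz hx), ih z hz (hA.mem_trans hz hx)⟩

end collapse

/-! ### Existence of `κ`-models -/

/-- A Skolem function for `φ`. -/
noncomputable def skolem {n : ℕ} (φ : setLang.BoundedFormula Empty (n + 1))
    (x : Fin n → ZFSet.{u}) : ZFSet.{u} :=
  Classical.epsilon fun b => φ.Realize Empty.elim (Fin.snoc x b : Fin (n + 1) → ZFSet.{u})

theorem countable_formulas : Countable (Σ n, setLang.BoundedFormula Empty (n + 1)) := by
  refine Function.Injective.countable (β := Σ n, setLang.BoundedFormula Empty n)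
    (f := fun p => ⟨p.1 + 1, p.2⟩) ?_
  rintro ⟨n, φ⟩ ⟨m, ψ⟩ h
  simp only [Sigma.mk.injEq, add_left_inj] at h
  obtain ⟨rfl, h⟩ := h
  simpa using h

/-- For inaccessible `κ`, there is an elementary substructure of the universe of size at most `κ`
that is closed under subsets of size less than `κ` and contains a given set of size at most `κ`. -/
theorem exists_closed_elementary {κ : Cardinal.{u + 1}} (hκ : κ.IsInaccessible)
    {A : Set ZFSet.{u}} (hA : #A ≤ κ) :
    ∃ X : setLang.ElementarySubstructure ZFSet.{u}, A ⊆ X ∧ #X ≤ κ ∧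
      ∀ s : ZFSet.{u}, (s : Set ZFSet.{u}) ⊆ X → #s < κ → s ∈ X := by
  -- `F s` contains the set with extension `s`, if there is one, and all Skolem values with
  -- parameters in `s`. Closure under `F` thus gives both closure under small subsets and the
  -- Tarski–Vaught test.
  let F : Set ZFSet.{u} → Set ZFSet.{u} := fun s => {x | (x : Set ZFSet.{u}) = s} ∪
    ⋃ p : ULift.{u + 1} (Σ n, setLang.BoundedFormula Empty (n + 1)),
      Set.range fun x : Fin p.down.1 → s => skolem p.down.2 fun i => (x i).1
  have hF (s : Set ZFSet.{u}) (hs : #s < κ) : #(F s) ≤ κ := by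
    refine (mk_union_le _ _).trans ((add_le_add ?_ ?_).trans (add_eq_self hκ.aleph0_lt.le).le)
    · have : Subsingleton {x : ZFSet.{u} | (x : Set ZFSet.{u}) = s} :=
        ⟨fun x y => Subtype.ext (SetLike.coe_injective (x.2.trans y.2.symm))⟩
      exact (le_one_iff_subsingleton.2 this).trans (one_lt_aleph0.le.trans hκ.aleph0_lt.le)
    · refine mk_iUnion_le_of_le hκ.aleph0_lt.le ?_ fun p => mk_range_le.trans ?_
      · have := countable_formulas
        exact mk_le_aleph0.trans hκ.aleph0_lt.le
      · simp only [mk_pi, prod_const, mk_fin, lift_natCast, lift_uzero]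
        exact (power_le_power_right hs.le).trans (power_nat_le hκ.aleph0_lt.le)
  obtain ⟨X, hAX, hX, hcl⟩ := exists_closed_superset hκ hA hF
  let S : setLang.Substructure ZFSet.{u} := ⟨X, fun f => Empty.elim f⟩
  refine ⟨S.toElementarySubstructure fun n φ x (a : ZFSet.{u}) ha => ?_, hAX, hX, fun s hs hsκ => ?_⟩
  · let s : Set ZFSet.{u} := Set.range fun i => (x i).1
    have hsX : s ⊆ X := by rintro _ ⟨i, rfl⟩; exact (x i).2
    have hsκ : #s < κ :=
      ((Set.finite_range _).lt_aleph0).trans hκ.aleph0_lt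
    refine ⟨⟨skolem φ fun i => (x i).1, hcl s hsX hsκ (Or.inr ?_)⟩, ?_⟩
    · exact Set.mem_iUnion.2 ⟨⟨n, φ⟩, fun i => ⟨(x i).1, i, rfl⟩, rfl⟩
    · rw [Subsingleton.elim (@default _ Unique.instInhabited : Empty → ZFSet.{u}) Empty.elim]
        at ha ⊢
      exact Classical.epsilon_spec (p := fun b => φ.Realize Empty.elim
        (Fin.snoc (fun i => (x i).1) b : Fin (n + 1) → ZFSet.{u})) ⟨a, ha⟩
  · exact hcl s hs hsκ (Or.inl rfl)

/-- Collapse an elementary submodel of the whole universe that has size `κ`, includes `A` and is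
closed under small subsets. The collapse is the identity on `A`, since `A` is transitive. -/
theorem exists_isKappaModel {T : setLang.Theory} (hT : T ⊆ ZFC) {κ : Cardinal.{u}}
    (hκ : κ.IsInaccessible) {A : ZFSet.{u}} (hA : A.IsTransitive) (hcard : A.card ≤ κ)
    (hκA : κ.ord.toZFSet ∈ A) : ∃ M : ZFSet.{u}, IsKappaModel T κ M ∧ A ⊆ M := by
  obtain ⟨X, hAX, hX, hcl⟩ := exists_closed_elementary (isInaccessible_lift.{u, u + 1} hκ)
    (A := A) (ZFSet.cardinalMk_coe_sort.trans_le (lift_le.2 hcard))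
  have hsmall : Small.{u} X := by
    rw [← mk_out κ, ← lift_id'.{u, u + 1} #X] at hX
    obtain ⟨f⟩ := lift_mk_le'.1 hX
    exact small_of_injective f.injective
  have hext : ∀ x ∈ (X : Set ZFSet.{u}), ∀ y ∈ (X : Set ZFSet.{u}),
      (∀ z ∈ (X : Set ZFSet.{u}), z ∈ x ↔ z ∈ y) → x = y := by
    have h := (X.realize_sentence extensionality).2 realize_extensionality
    simp only [Sentence.Realize, extensionality, Formula.Realize, BoundedFormula.realize_all,
      BoundedFormula.realize_imp, BoundedFormula.realize_iff, memF, BoundedFormula.realize_rel₂,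
      BoundedFormula.realize_bdEqual, realize_bvar] at h
    intro x hx y hy hxy
    exact congrArg Subtype.val (h ⟨x, hx⟩ ⟨y, hy⟩ fun z => hxy z.1 z.2)
  let π := collapse (X : Set ZFSet.{u})
  let M : ZFSet.{u} := ZFSet.range fun x : X => π x
  have hM (z : ZFSet.{u}) : z ∈ M ↔ ∃ x ∈ X, π x = z := by simp [M]
  have hMtr : M.IsTransitive := by
    intro y hy z hz
    obtain ⟨x, hx, rfl⟩ := (hM y).1 hy
    obtain ⟨w, -, hw, rfl⟩ := mem_collapse.1 hz
    exact (hM _).2 ⟨w, hw, rfl⟩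
  have hAM : A ⊆ M := fun x hx => (hM x).2 ⟨x, hAX hx, collapse_eq_self hA hAX hx⟩
  have hMcl (s : ZFSet.{u}) (hs : s ⊆ M) (hsκ : s.card < κ) : s ∈ M := by
    -- The preimages `t` of the elements of `s` form a small subset of `X`, hence an element of `X`,
    -- and `t` collapses to `s`.
    choose! f hfX hf using fun z (hz : z ∈ s) => (hM z).1 (hs hz)
    let t : ZFSet.{u} := ZFSet.range fun z : s => f z.1
    have ht (y) : y ∈ t ↔ ∃ z ∈ s, f z = y := by simp [t]
    refine (hM s).2 ⟨t, hcl t ?_ ?_, ?_⟩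
    · intro y hy
      obtain ⟨z, hz, rfl⟩ := (ht y).1 hy
      exact hfX z hz
    · exact ZFSet.cardinalMk_coe_sort.trans_lt (lift_lt.2 ((card_range_coe_le _ _).trans_lt hsκ))
    · ext z
      rw [mem_collapse]
      constructor
      · rintro ⟨y, hy, -, rfl⟩
        obtain ⟨z, hz, rfl⟩ := (ht y).1 hy
        change π (f z) ∈ s
        rwa [hf z hz]
      · exact fun hz => ⟨f z, (ht _).2 ⟨z, hz, rfl⟩, hfX z hz, hf z hz⟩
  let e : X ≃[setLang] Elems M :=
    { toEquiv := Equiv.ofBijective (fun x => ⟨π x, (hM _).2 ⟨x, x.2, rfl⟩⟩) (by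
        constructor
        · intro x y h
          exact Subtype.ext (collapse_injOn hext x.2 y.2 (Subtype.mk.inj h))
        · rintro ⟨z, hz⟩
          obtain ⟨x, hx, rfl⟩ := (hM z).1 hz
          exact ⟨⟨x, hx⟩, rfl⟩)
      map_fun' := fun f => Empty.elim f
      map_rel' := fun r xs => by
        cases r
        exact collapse_mem_collapse_iff hext (xs 0).2 }
  refine ⟨M, ⟨hMtr, ?_, hAM hκA, fun σ hσ => ?_, fun α hα f hf => ?_⟩, hAM⟩
  · apply le_antisymm
    · have := (ZFSet.lift_card_range_le.{u + 1, u} (f := fun x : X => π x)).trans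
        (lift_le.{u}.2 hX)
      simpa [← lift_umax.{u, u + 1}] using this
    · have := ZFSet.card_mono ((hA _ hκA).trans hAM)
      simpa using this
  · exact (StrongHomClass.realize_sentence e σ).1
      ((X.realize_sentence σ).2 (universe_models_ZFC (hT hσ)))
  · obtain ⟨hfs, hf⟩ := ZFSet.mem_funs.1 hf
    have hα' : α.card < κ := lt_ord.1 hα
    have hfin (a b : ZFSet.{u}) (ha : a ∈ M) (hb : b ∈ M) : {a, b} ∈ M := by
      refine hMcl _ (fun z hz => ?_) ?_
      · rcases ZFSet.mem_pair.1 hz with rfl | rfl <;> assumption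
      · refine (ZFSet.card_insert_le.trans (add_le_add_left ZFSet.card_singleton.le _)).trans_lt ?_
        exact_mod_cast hκ.nat_lt 2
    have hpair (a b : ZFSet.{u}) (ha : a ∈ M) (hb : b ∈ M) : ZFSet.pair a b ∈ M := by
      refine hfin _ _ ?_ (hfin a b ha hb)
      rw [← ZFSet.pair_eq_singleton]
      exact hfin a a ha ha
    refine hMcl f (fun p hp => ?_) ?_
    · obtain ⟨a, ha, b, hb, rfl⟩ := ZFSet.mem_prod.1 (hfs hp)
      obtain ⟨β, hβ, rfl⟩ := Ordinal.mem_toZFSet_iff.1 ha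
      refine hpair _ _ (hAM (hA _ hκA ?_)) hb
      exact Ordinal.toZFSet_mem_toZFSet_iff.2 (hβ.trans hα)
    · choose! w hw using hf
      have hfw : f ⊆ ZFSet.range fun z : α.toZFSet => ZFSet.pair z (w z.1) := by
        intro p hp
        obtain ⟨a, ha, b, hb, rfl⟩ := ZFSet.mem_prod.1 (hfs hp)
        rw [(hw a ha).2 b hp]
        exact ZFSet.mem_range.2 ⟨⟨a, ha⟩, rfl⟩
      refine ((ZFSet.card_mono hfw).trans (card_range_coe_le _ _)).trans_lt ?_
      simpa using hα'

end Unfoldable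
-- Formulas evaluated uniformly in transitive sets.
namespace Unfoldable

open FirstOrder FirstOrder.Language

theorem realize_memF {A : ZFSet.{u}} {α : Type} {n : ℕ} (t s : setLang.Term (α ⊕ Fin n))
    (v : α → Elems A) (xs : Fin n → Elems A) :
    (memF t s).Realize v xs ↔
      (t.realize (Sum.elim v xs)).1 ∈ (s.realize (Sum.elim v xs)).1 := by
  rw [memF, BoundedFormula.realize_rel₂]
  rfl

/-! ### Uniformly definable predicates -/

/-- A predicate on `n`-tuples from transitive sets is uniformly definable if a single formula
defines it in all of them. -/
def UDef (n : ℕ) (P : ∀ A : ZFSet.{u}, (Fin n → Elems A) → Prop) : Prop :=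
  ∃ φ : setLang.Formula (Fin n), ∀ A : ZFSet.{u}, A.IsTransitive → ∀ x : Fin n → Elems A,
    φ.Realize x ↔ P A x

namespace UDef

variable {n : ℕ} {P Q : ∀ A : ZFSet.{u}, (Fin n → Elems A) → Prop}

/-- Elementary embeddings between transitive sets preserve uniformly definable predicates. -/
theorem map (h : UDef n P) {M N : ZFSet.{u}} (hM : M.IsTransitive) (hN : N.IsTransitive)
    (j : Elems M ↪ₑ[setLang] Elems N) (x : Fin n → Elems M) (hx : P M x) : P N (j ∘ x) := by
  obtain ⟨φ, hφ⟩ := h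
  rw [← hφ N hN, j.map_formula, hφ M hM]
  exact hx

theorem congr (h : UDef n P)
    (hPQ : ∀ A : ZFSet.{u}, A.IsTransitive → ∀ x : Fin n → Elems A, P A x ↔ Q A x) : UDef n Q := by
  obtain ⟨φ, hφ⟩ := h
  exact ⟨φ, fun A hA x => (hφ A hA x).trans (hPQ A hA x)⟩

protected theorem mem (i k : Fin n) : UDef.{u} n fun _ x => (x i).1 ∈ (x k).1 :=
  ⟨memF (Term.var (Sum.inl i)) (Term.var (Sum.inl k)), fun _ _ _ => realize_memF _ _ _ _⟩

protected theorem eq (i k : Fin n) : UDef.{u} n fun _ x => (x i).1 = (x k).1 :=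
  ⟨Term.bdEqual (Term.var (Sum.inl i)) (Term.var (Sum.inl k)), fun _ _ _ => by
    rw [Formula.Realize, BoundedFormula.realize_bdEqual]
    exact Subtype.ext_iff⟩

protected theorem not (hP : UDef n P) : UDef n fun A x => ¬ P A x := by
  obtain ⟨φ, hφ⟩ := hP
  exact ⟨∼φ, fun A hA x => by rw [Formula.realize_not, hφ A hA]⟩

protected theorem imp (hP : UDef n P) (hQ : UDef n Q) : UDef n fun A x => P A x → Q A x := by
  obtain ⟨φ, hφ⟩ := hP
  obtain ⟨ψ, hψ⟩ := hQ
  exact ⟨φ ⟹ ψ, fun A hA x => by rw [Formula.realize_imp, hφ A hA, hψ A hA]⟩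

protected theorem and (hP : UDef n P) (hQ : UDef n Q) : UDef n fun A x => P A x ∧ Q A x := by
  obtain ⟨φ, hφ⟩ := hP
  obtain ⟨ψ, hψ⟩ := hQ
  exact ⟨φ ⊓ ψ, fun A hA x => by rw [Formula.realize_inf, hφ A hA, hψ A hA]⟩

protected theorem or (hP : UDef n P) (hQ : UDef n Q) : UDef n fun A x => P A x ∨ Q A x := by
  obtain ⟨φ, hφ⟩ := hP
  obtain ⟨ψ, hψ⟩ := hQ
  exact ⟨φ ⊔ ψ, fun A hA x => by rw [Formula.realize_sup, hφ A hA, hψ A hA]⟩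

protected theorem iff (hP : UDef n P) (hQ : UDef n Q) : UDef n fun A x => P A x ↔ Q A x := by
  obtain ⟨φ, hφ⟩ := hP
  obtain ⟨ψ, hψ⟩ := hQ
  exact ⟨φ.iff ψ, fun A hA x => by rw [Formula.realize_iff, hφ A hA, hψ A hA]⟩

protected theorem subst {m : ℕ} (hP : UDef n P) (f : Fin n → Fin m) :
    UDef m fun A x => P A fun i => x (f i) := by
  obtain ⟨φ, hφ⟩ := hP
  exact ⟨φ.relabel f, fun A hA x => by rw [Formula.realize_relabel, hφ A hA]; rfl⟩

protected theorem all {R : ∀ A : ZFSet.{u}, (Fin n → Elems A) → Elems A → Prop}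
    (h : UDef (n + 1) fun A x => R A (fun i => x i.castSucc) (x (Fin.last n))) :
    UDef n fun A x => ∀ y, R A x y := by
  obtain ⟨φ, hφ⟩ := h
  let g : Fin (n + 1) → Fin n ⊕ Fin 1 := Fin.lastCases (Sum.inr 0) Sum.inl
  refine ⟨(φ.relabel g).iAlls (Fin 1), fun A hA x => ?_⟩
  rw [Formula.realize_iAlls]
  constructor
  · intro h y
    have := h fun _ => y
    rw [Formula.realize_relabel, hφ A hA] at this
    simpa [g] using this
  · intro h i
    rw [Formula.realize_relabel, hφ A hA]
    simpa [g] using h (i 0)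

protected theorem ex {R : ∀ A : ZFSet.{u}, (Fin n → Elems A) → Elems A → Prop}
    (h : UDef (n + 1) fun A x => R A (fun i => x i.castSucc) (x (Fin.last n))) :
    UDef n fun A x => ∃ y, R A x y :=
  (UDef.all (R := fun A x y => ¬ R A x y) h.not).not.congr fun _ _ _ => by push Not; rfl

protected theorem subset (i k : Fin n) : UDef.{u} n fun _ x => (x i).1 ⊆ (x k).1 := by
  refine UDef.congr (P := fun A x => ∀ y : Elems A, y.1 ∈ (x i).1 → y.1 ∈ (x k).1)
    (.all (.imp (.mem _ i.castSucc) (.mem _ k.castSucc))) fun A hA x => ?_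
  exact ⟨fun h y hy => h ⟨y, hA.mem_trans hy (x i).2⟩ hy, fun h y hy => h hy⟩

protected theorem eq_sUnion (i k : Fin n) :
    UDef.{u} n fun _ x => (x i).1 = (ZFSet.sUnion (x k).1 : ZFSet.{u}) := by
  refine UDef.congr (P := fun A x => ∀ y : Elems A, y.1 ∈ (x i).1 ↔
      ∃ z : Elems A, z.1 ∈ (x k).1 ∧ y.1 ∈ z.1)
    (.all (.iff (.mem _ i.castSucc) (.ex (.and (.mem _ k.castSucc.castSucc)
      (.mem (Fin.last n).castSucc _))))) fun A hA x => ?_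
  constructor
  · intro h
    ext y
    rw [ZFSet.mem_sUnion]
    constructor
    · intro hy
      obtain ⟨z, hz⟩ := (h ⟨y, hA.mem_trans hy (x i).2⟩).1 hy
      exact ⟨z.1, hz⟩
    · rintro ⟨z, hz, hy⟩
      have hzA := hA.mem_trans hz (x k).2
      exact (h ⟨y, hA.mem_trans hy hzA⟩).2 ⟨⟨z, hzA⟩, hz, hy⟩
  · intro h y
    rw [h, ZFSet.mem_sUnion]
    exact ⟨fun ⟨z, hz, hy⟩ => ⟨⟨z, hA.mem_trans hz (x k).2⟩, hz, hy⟩, fun ⟨z, hz⟩ => ⟨z.1, hz⟩⟩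

protected theorem eq_unordered_pair (i k l : Fin n) :
    UDef.{u} n fun _ x => (x i).1 = ({(x k).1, (x l).1} : ZFSet.{u}) := by
  refine UDef.congr (P := fun A x => ∀ y : Elems A, y.1 ∈ (x i).1 ↔
      (y.1 = (x k).1 ∨ y.1 = (x l).1))
    (.all (.iff (.mem _ i.castSucc) (.or (.eq _ k.castSucc) (.eq _ l.castSucc)))) fun A hA x => ?_
  constructor
  · intro h
    ext y
    rw [ZFSet.mem_pair]
    constructor
    · exact fun hy => (h ⟨y, hA.mem_trans hy (x i).2⟩).1 hy
    · rintro (rfl | rfl)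
      exacts [(h _).2 (Or.inl rfl), (h _).2 (Or.inr rfl)]
  · intro h y
    rw [h, ZFSet.mem_pair]

protected theorem eq_pair (i k l : Fin n) :
    UDef.{u} n fun _ x => (x i).1 = ZFSet.pair (x k).1 (x l).1 := by
  -- The singleton in the Kuratowski pair is written as an unordered pair; both components `y` and
  -- `z` lie in `A` by transitivity.
  refine UDef.congr (P := fun A x => ∃ y z : Elems A, y.1 = {(x k).1, (x k).1} ∧
      z.1 = {(x k).1, (x l).1} ∧ (x i).1 = ({y.1, z.1} : ZFSet.{u}))
    (.ex (.ex (.and (.eq_unordered_pair (Fin.last n).castSucc k.castSucc.castSucc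
      k.castSucc.castSucc) (.and (.eq_unordered_pair _ k.castSucc.castSucc l.castSucc.castSucc)
      (.eq_unordered_pair i.castSucc.castSucc (Fin.last n).castSucc _))))) fun A hA x => ?_
  constructor
  · rintro ⟨y, z, hy, hz, h⟩
    rw [h, hy, hz, ZFSet.pair_eq_singleton]
    rfl
  · intro h
    have hk : {(x k).1} ∈ A := hA.mem_trans (by simp [ZFSet.pair]) (h ▸ (x i).2)
    have hl : {(x k).1, (x l).1} ∈ A := hA.mem_trans (by simp [ZFSet.pair]) (h ▸ (x i).2)
    exact ⟨⟨_, hk⟩, ⟨_, hl⟩, by simp, rfl, h⟩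

end UDef

/-! ### Relativized satisfaction -/

/-- Terms of `setPredLang` are variables. -/
def termTr {n : ℕ} : setPredLang.Term (Empty ⊕ Fin n) → setLang.Term (Fin 3 ⊕ Fin n)
  | .var (.inl e) => Empty.elim e
  | .var (.inr i) => .var (.inr i)
  | .func f _ => Empty.elim f

/-- The relativization of a formula to the first parameter, the predicate being interpreted as the
intersection of the other two parameters. -/
def relativize : {n : ℕ} → setPredLang.BoundedFormula Empty n → setLang.BoundedFormula (Fin 3) n
  | _, .falsum => .falsum
  | _, .equal t s => .equal (termTr t) (termTr s)
  | _, .rel r ts => match r, ts with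
    | SetPredRel.mem, ts => memF (termTr (ts 0)) (termTr (ts 1))
    | SetPredRel.pred, ts =>
      memF (termTr (ts 0)) (.var (.inl 1)) ⊓ memF (termTr (ts 0)) (.var (.inl 2))
  | _, .imp φ ψ => .imp (relativize φ) (relativize ψ)
  | n, .all φ => .all (.imp (memF (.var (.inr (Fin.last n))) (.var (.inl 0))) (relativize φ))

/-- The predicate is passed as two parameters, so that their intersection need not be an element of
`A`. -/
theorem realize_relativize {A : ZFSet.{u}} (hA : A.IsTransitive) (v : Fin 3 → Elems A) {n : ℕ}
    (φ : setPredLang.BoundedFormula Empty n) (d : Empty → Elems (v 0).1)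
    (xs : Fin n → Elems (v 0).1) :
    (relativize φ).Realize v (fun i => ⟨(xs i).1, hA.mem_trans (xs i).2 (v 0).2⟩) ↔
      @BoundedFormula.Realize setPredLang (Elems (v 0).1)
        (predStructure (v 0).1 ((v 1).1 ∩ (v 2).1)) _ _ φ d xs := by
  let := predStructure (v 0).1 ((v 1).1 ∩ (v 2).1)
  have ht {n : ℕ} (xs : Fin n → Elems (v 0).1) (t : setPredLang.Term (Empty ⊕ Fin n)) :
      ((termTr t).realize (Sum.elim v fun i =>
        (⟨(xs i).1, hA.mem_trans (xs i).2 (v 0).2⟩ : Elems A))).1 =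
        (t.realize (Sum.elim d xs)).1 := by
    rcases t with (e | i) | ⟨f, _⟩
    · exact e.elim
    · rfl
    · exact Empty.elim f
  induction φ with
  | falsum => rfl
  | equal t s =>
    refine Iff.trans Subtype.ext_iff (Iff.trans ?_ Subtype.ext_iff.symm)
    rw [ht, ht]
  | rel r ts =>
    cases r with
    | mem =>
      refine (realize_memF _ _ _ _).trans ?_
      rw [ht, ht]
      rfl
    | pred =>
      refine BoundedFormula.realize_inf.trans ?_
      rw [realize_memF, realize_memF, ht]
      exact ZFSet.mem_inter.symm
  | imp φ ψ ihφ ihψ => exact imp_congr (ihφ xs) (ihψ xs)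
  | all φ ih =>
    rw [relativize, BoundedFormula.realize_all, BoundedFormula.realize_all]
    have hs {n : ℕ} (xs : Fin n → Elems (v 0).1) (y : Elems (v 0).1) :
        (fun i => (⟨((Fin.snoc xs y : Fin (n + 1) → Elems (v 0).1) i).1,
          hA.mem_trans (Subtype.prop _) (v 0).2⟩ : Elems A)) =
        Fin.snoc (α := fun _ => Elems A) (fun i => ⟨(xs i).1, hA.mem_trans (xs i).2 (v 0).2⟩)
          ⟨y.1, hA.mem_trans y.2 (v 0).2⟩ := by
      funext i
      refine Fin.lastCases ?_ (fun i => ?_) i <;> simp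
    constructor
    · intro h y
      have := h ⟨y.1, hA.mem_trans y.2 (v 0).2⟩
      rw [BoundedFormula.realize_imp, realize_memF, ← hs] at this
      refine (ih _).1 (this ?_)
      simp [y.2]
    · intro h y
      rw [BoundedFormula.realize_imp, realize_memF]
      intro hy
      have hy : y.1 ∈ (v 0).1 := by simpa using hy
      have := (ih _).2 (h ⟨y.1, hy⟩)
      rwa [hs] at this

protected theorem UDef.predSat (σ : setPredLang.Sentence) :
    UDef.{u} 3 fun _ x => PredSat (x 0).1 ((x 1).1 ∩ (x 2).1) σ := by
  refine ⟨relativize σ, fun A hA x => ?_⟩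
  refine Iff.trans ?_ (realize_relativize hA x σ default default)
  rw [Formula.Realize, Subsingleton.elim (fun i => _) (default : Fin 0 → Elems A)]

/-- In the transitive set `A`, the structure `⟨w', ∈, R ∩ v⟩` satisfies `σ`, where `w'` is the
`m`-th iterated power set of `w`. -/
def Sat (σ : setPredLang.Sentence) (A : ZFSet.{u}) : ℕ → Elems A → Elems A → Elems A → Prop
  | 0, w, R, v => PredSat w.1 (R.1 ∩ v.1) σ
  | m + 1, w, R, v => ∃ p : Elems A, (∀ x : Elems A, x.1 ∈ p.1 ↔ x.1 ⊆ w.1) ∧ Sat σ A m p R v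

protected theorem UDef.sat (σ : setPredLang.Sentence) (m : ℕ) :
    UDef.{u} 3 fun A x => Sat σ A m (x 0) (x 1) (x 2) := by
  induction m with
  | zero => exact .predSat σ
  | succ m ih =>
    -- Variables 0, 1, 2 are `w`, `R`, `v`; 3 is the power set `p` and 4 its prospective element.
    exact .ex (.and (.all (.iff (.mem 4 3) (.subset 4 0))) (ih.subst ![3, 1, 2]))

/-- Power sets are peeled off at the bottom: `A` contains all subsets of `V_β`, so its power set of
`w` is `V_{β+1}`, and the case `(β, m + 1)` becomes `(β + 1, m)`. -/
theorem sat_iff {A : ZFSet.{u}} (hAt : A.IsTransitive) (σ : setPredLang.Sentence) {m : ℕ} {β : Ordinal.{u}}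
    (hA : ZFSet.vonNeumann (β + m + 1) ⊆ A) {w R v : Elems A} (hw : w.1 = ZFSet.vonNeumann β) :
    Sat σ A m w R v ↔ PredSat (ZFSet.vonNeumann (β + m)) (R.1 ∩ v.1) σ := by
  induction m generalizing β w with
  | zero => rw [Sat, hw]; simp
  | succ m ih =>
    have e : β + 1 + m = β + (m + 1 : ℕ) := by
      rw [add_assoc, ← Nat.cast_one, ← Nat.cast_add, add_comm]
    rw [← e] at hA ⊢
    have hsub {x : ZFSet.{u}} (hx : x ⊆ ZFSet.vonNeumann (β + 1)) : x ∈ A := by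
      refine hA (ZFSet.mem_vonNeumann.2 ((ZFSet.subset_vonNeumann.1 hx).trans_lt ?_))
      exact Order.lt_add_one_iff.2 (le_self_add)
    constructor
    · rintro ⟨p, hp, h⟩
      refine (ih hA ?_).1 h
      ext x
      rw [ZFSet.vonNeumann_add_one, ZFSet.mem_powerset, ← hw]
      constructor
      · exact fun hx => (hp ⟨x, hAt.mem_trans hx p.2⟩).1 hx
      · intro hx
        refine (hp ⟨x, hsub ?_⟩).2 hx
        exact (hw ▸ hx).trans (ZFSet.vonNeumann_subset_of_le le_self_add)
    · intro h
      refine ⟨⟨_, hsub subset_rfl⟩, fun x => ?_, (ih hA rfl).2 h⟩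
      change x.1 ∈ ZFSet.vonNeumann (β + 1) ↔ _
      rw [ZFSet.vonNeumann_add_one, ZFSet.mem_powerset, hw]

end Unfoldable
-- The action of `j` on `V_lam` and on sets of levels.
namespace Unfoldable

open FirstOrder FirstOrder.Language Cardinal

/-! ### Sets of levels of the von Neumann hierarchy -/

/-- The set of the levels `V_γ` with `γ ∈ C`. -/
noncomputable def levels {lam : Ordinal.{u}} (C : Set (Set.Iio lam)) : ZFSet.{u} :=
  ZFSet.range fun γ : C => ZFSet.vonNeumann γ.1.1

theorem mem_levels {lam : Ordinal.{u}} {C : Set (Set.Iio lam)} {x : ZFSet.{u}} :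
    x ∈ levels C ↔ ∃ γ ∈ C, ZFSet.vonNeumann γ.1 = x := by
  simp [levels]

theorem levels_subset {lam : Ordinal.{u}} (C : Set (Set.Iio lam)) :
    levels C ⊆ ZFSet.vonNeumann lam := by
  intro x hx
  obtain ⟨γ, -, rfl⟩ := mem_levels.1 hx
  exact ZFSet.vonNeumann_mem_of_lt γ.2

/-- If `s = {V_γ | γ ∈ t}`, then `⋃ s = V_{sup t}`. The supremum appears as the rank of `⋃ s`; it is
below `lam` because `s` is, and lies in `C` by closure. -/
theorem sUnion_mem_levels {lam : Ordinal.{u}} {C : Set (Set.Iio lam)} (hC : DirSupClosed C)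
    {s : ZFSet.{u}} (hs : s ⊆ levels C) (hne : s.Nonempty) (hlam : s.rank < lam) :
    (ZFSet.sUnion s : ZFSet.{u}) ∈ levels C := by
  have hβ : (ZFSet.sUnion s : ZFSet.{u}).rank < lam := (ZFSet.rank_sUnion_le s).trans_lt hlam
  let t : Set (Set.Iio lam) := {γ | ZFSet.vonNeumann γ.1 ∈ s}
  have htC : t ⊆ C := by
    intro γ hγ
    obtain ⟨δ, hδ, h⟩ := mem_levels.1 (hs hγ)
    rwa [← Subtype.ext (ZFSet.vonNeumann_injective h)]
  have hst {y : ZFSet.{u}} (hy : y ∈ s) : ∃ γ ∈ t, ZFSet.vonNeumann γ.1 = y := by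
    obtain ⟨γ, -, rfl⟩ := mem_levels.1 (hs hy)
    exact ⟨γ, hy, rfl⟩
  refine mem_levels.2 ⟨⟨_, hβ⟩, hC htC ?_ (.of_linearOrder _) ⟨?_, ?_⟩, ?_⟩
  · obtain ⟨y, hy⟩ := hne
    obtain ⟨γ, hγ, -⟩ := hst hy
    exact ⟨γ, hγ⟩
  · intro γ hγ
    have : ZFSet.vonNeumann γ.1 ⊆ (ZFSet.sUnion s : ZFSet.{u}) :=
      fun x hx => ZFSet.mem_sUnion_of_mem hx hγ
    change γ.1 ≤ _
    simpa using ZFSet.rank_mono this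
  · intro δ hδ
    refine ZFSet.subset_vonNeumann.1 fun x hx => ?_
    obtain ⟨y, hy, hxy⟩ := ZFSet.mem_sUnion.1 hx
    obtain ⟨γ, hγ, rfl⟩ := hst hy
    exact ZFSet.vonNeumann_subset_of_le (hδ hγ) hxy
  · refine le_antisymm (fun x hx => ?_) (ZFSet.subset_vonNeumann_self _)
    obtain ⟨y, hy, hxy⟩ := ZFSet.lt_rank_iff.1 (ZFSet.mem_vonNeumann.1 hx)
    obtain ⟨z, hz, hyz⟩ := ZFSet.mem_sUnion.1 hy
    obtain ⟨γ, hγ, rfl⟩ := hst hz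
    refine ZFSet.mem_sUnion_of_mem ?_ hz
    exact ZFSet.mem_vonNeumann.2 (hxy.trans_lt (ZFSet.mem_vonNeumann.1 hyz))

/-! ### Elementary embeddings fixing the ordinals below `lam` -/

section embedding

variable {lam : Ordinal.{u}} {M N : ZFSet.{u}} (hM : M.IsTransitive) (hN : N.IsTransitive)
  (hVM : ZFSet.vonNeumann lam ⊆ M) (hVN : ZFSet.vonNeumann (lam + 1) ⊆ N)
  {j : Elems M ↪ₑ[setLang] Elems N}
  (hj : ∀ α < lam, ∀ h : α.toZFSet ∈ M, (j ⟨α.toZFSet, h⟩).1 = α.toZFSet)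

include hM hN in
theorem mem_map_iff (x y : Elems M) : (j x).1 ∈ (j y).1 ↔ x.1 ∈ y.1 :=
  ⟨fun h => by_contra fun h' =>
    (UDef.mem (n := 2) 0 1).not.map hM hN j ![x, y] h' h,
    fun h => (UDef.mem (n := 2) 0 1).map hM hN j ![x, y] h⟩

include hM hN hVM hj in
-- Only ordinals are known to be fixed, so `j x` might acquire new elements. That `y ∈ x` has rank
-- at most some `a < rank x` is expressed by the levels in `W`: each one including `a` includes `y`.
-- As `j` fixes `rank x` and, inductively, every `V_α` with `α < rank x`, the elements of `j x` have
-- rank below `rank x`, and the induction hypothesis applies to them.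
theorem map_eq_self (W : Elems M) (hW : W.1 = levels (Set.univ : Set (Set.Iio lam)))
    (x : Elems M) (hx : x.1 ∈ ZFSet.vonNeumann lam) : (j x).1 = x.1 := by
  induction hρ : x.1.rank using WellFoundedLT.induction generalizing x with
  | ind ρ ih =>
  subst hρ
  have hxlam := ZFSet.mem_vonNeumann.1 hx
  let r : Elems M := ⟨x.1.rank.toZFSet, hVM (ZFSet.mem_vonNeumann.2 (by simpa using hxlam))⟩
  have hr : (j r).1 = x.1.rank.toZFSet := hj _ hxlam _
  have hVW {α : Ordinal.{u}} (hα : α < lam) : ZFSet.vonNeumann α ∈ W.1 := by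
    rw [hW]
    exact mem_levels.2 ⟨⟨α, hα⟩, trivial, rfl⟩
  have key := UDef.map (n := 3) (P := fun A z => ∀ y : Elems A, y.1 ∈ (z 0).1 →
    ∃ a : Elems A, a.1 ∈ (z 1).1 ∧ ∀ v : Elems A, v.1 ∈ (z 2).1 → a.1 ⊆ v.1 → y.1 ⊆ v.1)
    (.all (.imp (.mem 3 0) (.ex (.and (.mem 4 1) (.all (.imp (.mem 5 2)
      (.imp (.subset 4 5) (.subset 3 5)))))))) hM hN j ![x, r, W] (by
      intro y hy
      have hyr := ZFSet.rank_lt_of_mem hy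
      refine ⟨⟨y.1.rank.toZFSet, hVM (ZFSet.mem_vonNeumann.2
        (by simpa using hyr.trans hxlam))⟩, ?_, ?_⟩
      · simpa [r] using hyr
      · intro v hv hav
        change v.1 ∈ W.1 at hv
        rw [hW] at hv
        obtain ⟨γ, -, hγ⟩ := mem_levels.1 hv
        rw [← hγ, ZFSet.subset_vonNeumann] at hav ⊢
        simpa using hav)
  ext y
  constructor
  · intro hy
    obtain ⟨a, ha, h⟩ := key ⟨y, hN.mem_trans hy (j x).2⟩ hy
    change a.1 ∈ (j r).1 at ha
    rw [hr] at ha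
    obtain ⟨α, hα, hαa⟩ := Ordinal.mem_toZFSet_iff.1 ha
    have hαlam := hα.trans hxlam
    let v : Elems M := ⟨ZFSet.vonNeumann α, hVM (ZFSet.vonNeumann_mem_of_lt hαlam)⟩
    have hv : (j v).1 = ZFSet.vonNeumann α :=
      ih α hα v (ZFSet.vonNeumann_mem_of_lt hαlam) (by simp [v])
    have hyv : y ⊆ (j v).1 := h (j v) ((mem_map_iff hM hN v W).2 (hVW hαlam)) (by
      rw [hv, ← hαa]
      exact α.toZFSet_subset_vonNeumann)
    rw [hv, ZFSet.subset_vonNeumann] at hyv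
    have hyV : y ∈ ZFSet.vonNeumann lam := ZFSet.mem_vonNeumann.2 (hyv.trans_lt hαlam)
    have hjy := ih _ (hyv.trans_lt hα) ⟨y, hVM hyV⟩ hyV rfl
    exact (mem_map_iff hM hN ⟨y, hVM hyV⟩ x).1 (by rwa [hjy])
  · intro hy
    have hyV := (ZFSet.isTransitive_vonNeumann lam).mem_trans hy hx
    have hjy := ih _ (ZFSet.rank_lt_of_mem hy) ⟨y, hVM hyV⟩ hyV rfl
    simpa [hjy] using (mem_map_iff (j := j) hM hN ⟨y, hVM hyV⟩ x).2 hy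

include hM hN hVM hVN in
/-- If `C` is a club subset of `lam` and `V_lam` is fixed pointwise by `j`, then `V_lam` is an
element of the image of the set of levels given by `C`. -/
theorem vonNeumann_mem_map_levels (hlam : Order.IsSuccLimit lam)
    (hfix : ∀ x : Elems M, x.1 ∈ ZFSet.vonNeumann lam → (j x).1 = x.1)
    {K U W : Elems M} (hK : K.1 = lam.toZFSet) (hjK : lam.toZFSet ∈ (j K).1)
    (hU : U.1 = ZFSet.vonNeumann lam) {C : Set (Set.Iio lam)} (hC : IsClub C)
    (hW : W.1 = levels C) : ZFSet.vonNeumann lam ∈ (j W).1 := by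
  have hmemW {v : ZFSet.{u}} (hv : v ∈ W.1) : ∃ γ ∈ C, ZFSet.vonNeumann γ.1 = v :=
    mem_levels.1 (hW ▸ hv)
  have hcof (α : Ordinal.{u}) (hα : α < lam) : ∃ γ : Set.Iio lam, α ≤ γ.1 ∧
      ZFSet.vonNeumann γ.1 ∈ W.1 := by
    obtain ⟨γ, hγ, h⟩ := hC.isCofinal ⟨α, hα⟩
    exact ⟨γ, h, hW ▸ mem_levels.2 ⟨γ, hγ, rfl⟩⟩
  have hWV : W.1 ⊆ ZFSet.vonNeumann lam := hW ▸ levels_subset C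
  have hjW {v : ZFSet.{u}} (hv : v ∈ W.1) : v ∈ (j W).1 := by
    have hvV := hWV hv
    have := (mem_map_iff (j := j) hM hN ⟨v, hVM hvV⟩ W).2 hv
    rwa [hfix ⟨v, hVM hvV⟩ hvV] at this
  -- Four properties of `W` are transferred. Cofinality at `lam ∈ j K` gives `v ∈ j W` including
  -- `lam`; comparability with the fixed levels in `W` gives `V_lam ⊆ v`; downward closure then puts
  -- `W` itself into `j U`; and closure under unions, applied to `s = W`, gives `⋃ W = V_lam ∈ j W`.
  have hcofinal := UDef.map (n := 2) (P := fun A z => ∀ a : Elems A, a.1 ∈ (z 0).1 →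
    ∃ v : Elems A, v.1 ∈ (z 1).1 ∧ a.1 ⊆ v.1)
    (.all (.imp (.mem 2 0) (.ex (.and (.mem 3 1) (.subset 2 3))))) hM hN j ![K, W] (by
      intro a ha
      change a.1 ∈ K.1 at ha
      rw [hK] at ha
      obtain ⟨α, hα, hαa⟩ := Ordinal.mem_toZFSet_iff.1 ha
      obtain ⟨γ, hγ, h⟩ := hcof α hα
      refine ⟨⟨_, hVM (hWV h)⟩, h, ?_⟩
      rw [← hαa]
      exact α.toZFSet_subset_vonNeumann.trans (ZFSet.vonNeumann_subset_of_le hγ))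
  have hchain := UDef.map (n := 1) (P := fun A z => ∀ v w : Elems A, v.1 ∈ (z 0).1 →
    w.1 ∈ (z 0).1 → v.1 ⊆ w.1 ∨ w.1 ⊆ v.1)
    (.all (.all (.imp (.mem 1 0) (.imp (.mem 2 0) (.or (.subset 1 2) (.subset 2 1))))))
    hM hN j ![W] (by
      intro v w hv hw
      obtain ⟨γ, -, hγ⟩ := hmemW hv
      obtain ⟨δ, -, hδ⟩ := hmemW hw
      rw [← hγ, ← hδ]
      simp only [ZFSet.vonNeumann_subset_vonNeumann_iff]
      exact le_total _ _)
  have hdown := UDef.map (n := 2) (P := fun A z => ∀ x v : Elems A, v.1 ∈ (z 1).1 →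
    x.1 ⊆ v.1 → x.1 ∈ (z 0).1)
    (.all (.all (.imp (.mem 3 1) (.imp (.subset 2 3) (.mem 2 0))))) hM hN j ![U, W] (by
      intro x v hv hxv
      obtain ⟨γ, -, hγ⟩ := hmemW hv
      change x.1 ∈ U.1
      rw [hU]
      exact ZFSet.mem_vonNeumann_of_subset (hγ ▸ hxv) (ZFSet.vonNeumann_mem_of_lt γ.2))
  have hsup := UDef.map (n := 2) (P := fun A z => ∀ s : Elems A, s.1 ∈ (z 0).1 →
    (∃ y : Elems A, y.1 ∈ s.1) → s.1 ⊆ (z 1).1 →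
      ∃ t : Elems A, t.1 ∈ (z 1).1 ∧ t.1 = (ZFSet.sUnion s.1 : ZFSet.{u}))
    (.all (.imp (.mem 2 0) (.imp (.ex (.mem 3 2)) (.imp (.subset 2 1)
      (.ex (.and (.mem 3 1) (.eq_sUnion 3 2))))))) hM hN j ![U, W] (by
      intro s hs ⟨y, hy⟩ hsW
      change s.1 ∈ U.1 at hs
      change s.1 ⊆ W.1 at hsW
      rw [hU, ZFSet.mem_vonNeumann] at hs
      have h := sUnion_mem_levels hC.dirSupClosed (hW ▸ hsW) ⟨y.1, hy⟩ hs
      rw [← hW] at h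
      exact ⟨⟨_, hVM (hWV h)⟩, h, rfl⟩)
  have hsub {x : ZFSet.{u}} (hx : x ⊆ ZFSet.vonNeumann lam) : x ∈ N :=
    hVN (by rwa [ZFSet.vonNeumann_add_one, ZFSet.mem_powerset])
  have hVW : (ZFSet.sUnion W.1 : ZFSet.{u}) = ZFSet.vonNeumann lam := by
    ext x
    rw [ZFSet.mem_sUnion]
    constructor
    · rintro ⟨v, hv, hxv⟩
      exact (ZFSet.isTransitive_vonNeumann lam).mem_trans hxv (hWV hv)
    · intro hx
      rw [ZFSet.mem_vonNeumann] at hx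
      obtain ⟨γ, hγ, h⟩ := hcof _ (hlam.succ_lt hx)
      exact ⟨_, h, ZFSet.mem_vonNeumann.2 (Order.succ_le_iff.1 hγ)⟩
  obtain ⟨v, hv, hKv⟩ := hcofinal ⟨lam.toZFSet, hN.mem_trans hjK (j K).2⟩ hjK
  have hVv : ZFSet.vonNeumann lam ⊆ v.1 := by
    rw [← hVW]
    intro x hx
    obtain ⟨w, hw, hxw⟩ := ZFSet.mem_sUnion.1 hx
    have hwN := hN.mem_trans (hjW hw) (j W).2
    rcases hchain ⟨w, hwN⟩ v (hjW hw) hv with h | h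
    · exact h hxw
    · obtain ⟨γ, -, rfl⟩ := hmemW hw
      have := ZFSet.subset_vonNeumann.1 (hKv.trans h)
      rw [Ordinal.rank_toZFSet] at this
      exact absurd γ.2 this.not_gt
  obtain ⟨γ, -, hγ⟩ := hcof 0 hlam.bot_lt
  obtain ⟨t, ht, hts⟩ := hsup ⟨W.1, hsub hWV⟩
    (hdown ⟨W.1, hsub hWV⟩ v hv (hWV.trans hVv))
    ⟨⟨_, hN.mem_trans (hjW hγ) (j W).2⟩, hγ⟩ (fun x hx => hjW hx)
  rw [← hVW, ← hts]
  exact ht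

end embedding

end Unfoldable
-- Total indescribability and stationarity.
namespace Unfoldable

open FirstOrder FirstOrder.Language Cardinal

theorem pair_mem_vonNeumann {lam : Ordinal.{u}} (hlam : Order.IsSuccLimit lam) {x y : ZFSet.{u}}
    (hx : x ∈ ZFSet.vonNeumann lam) (hy : y ∈ ZFSet.vonNeumann lam) :
    ZFSet.pair x y ∈ ZFSet.vonNeumann lam := by
  rw [ZFSet.mem_vonNeumann] at *
  simp only [ZFSet.pair, ZFSet.rank_pair, ZFSet.rank_singleton]
  exact max_lt (hlam.succ_lt (hlam.succ_lt hx)) (hlam.succ_lt (max_lt (hlam.succ_lt hx)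
    (hlam.succ_lt hy)))

theorem sat_iff_of_lt {lam : Ordinal.{u}} (hlam : Order.IsSuccLimit lam) {A : ZFSet.{u}}
    (hA : A.IsTransitive) (hVA : ZFSet.vonNeumann lam ⊆ A) (σ : setPredLang.Sentence) (m : ℕ)
    {β : Ordinal.{u}} (hβ : β < lam) {w R v : Elems A} (hw : w.1 = ZFSet.vonNeumann β) :
    Sat σ A m w R v ↔ PredSat (ZFSet.vonNeumann (β + m)) (R.1 ∩ v.1) σ := by
  have h (k : ℕ) : β + k < lam := by
    induction k with
    | zero => simpa using hβ
    | succ k ih => simpa [add_assoc] using hlam.succ_lt ih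
  refine sat_iff hA σ (.trans (ZFSet.vonNeumann_subset_of_le ?_) hVA) hw
  simpa [add_assoc] using (h (m + 1)).le

/-- If `κ` is `(κ + ω)`-strongly unfoldable, then for finitely many subsets `p i` of `V_κ` there
are a transitive set `M` containing them and an elementary embedding `j : M → N` fixing `V_κ`
pointwise such that `V_{κ+ω} ⊆ N` and `V_κ` is an element of `j` of every club set of levels. -/
theorem IsStronglyUnfoldableTo.exists_embedding {T : setLang.Theory} (hT : T ⊆ ZFC)
    {κ : Cardinal.{u}} (hκ : IsStronglyUnfoldableTo T κ (κ.ord + Ordinal.omega0))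
    {n : ℕ} (p : Fin n → ZFSet.{u}) (hp : ∀ i, p i ⊆ ZFSet.vonNeumann κ.ord) :
    ∃ (M N : ZFSet.{u}) (j : Elems M ↪ₑ[setLang] Elems N), M.IsTransitive ∧ N.IsTransitive ∧
      ZFSet.vonNeumann κ.ord ⊆ M ∧ (∀ i, p i ∈ M) ∧
      ZFSet.vonNeumann (κ.ord + Ordinal.omega0) ⊆ N ∧
      (∀ x : Elems M, x.1 ∈ ZFSet.vonNeumann κ.ord → (j x).1 = x.1) ∧
      ∀ (W : Elems M) (C : Set (Set.Iio κ.ord)), IsClub C → W.1 = levels C →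
        ZFSet.vonNeumann κ.ord ∈ (j W).1 := by
  obtain ⟨hκi, hκ⟩ := hκ
  let V := ZFSet.vonNeumann κ.ord
  -- These are the parameters `U` and `K` of `vonNeumann_mem_map_levels` and `W` of `map_eq_self`,
  -- which must lie in `M`.
  let q : Fin 3 → ZFSet.{u} := ![V, κ.ord.toZFSet, levels (Set.univ : Set (Set.Iio κ.ord))]
  have hq (i : Fin 3) : q i ⊆ V := by
    fin_cases i
    exacts [subset_rfl, κ.ord.toZFSet_subset_vonNeumann, levels_subset _]
  let A : ZFSet.{u} := V ∪ (ZFSet.range q ∪ ZFSet.range p)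
  have hVA : V ⊆ A := fun x hx => ZFSet.mem_union.2 (Or.inl hx)
  have hqA (i : Fin 3) : q i ∈ A := by simp [A]
  have hpA (i : Fin n) : p i ∈ A := by simp [A]
  have hA : A.IsTransitive := by
    intro x hx
    have hV := ZFSet.isTransitive_vonNeumann κ.ord
    rcases ZFSet.mem_union.1 hx with hx | hx
    · exact (hV x hx).trans hVA
    rcases ZFSet.mem_union.1 hx with hx | hx
    · obtain ⟨i, rfl⟩ := ZFSet.mem_range.1 hx
      exact (hq i).trans hVA
    · obtain ⟨i, rfl⟩ := ZFSet.mem_range.1 hx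
      exact (hp i).trans hVA
  have hfin {k : ℕ} (f : Fin k → ZFSet.{u}) : (ZFSet.range f).card ≤ κ := by
    have h := ZFSet.lift_card_range_le (f := f)
    simp only [lift_uzero, mk_fin, lift_natCast] at h
    exact h.trans (hκi.nat_lt k).le
  have hcard : A.card ≤ κ := by
    have hV : V.card ≤ κ := (ZFSet.card_vonNeumann _).trans_le hκi.preBeth_ord.le
    refine ZFSet.card_union_le.trans ((add_le_add hV (ZFSet.card_union_le.trans
      (add_le_add (hfin q) (hfin p)))).trans ?_)
    simp [add_eq_self hκi.aleph0_lt.le]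
  obtain ⟨M, hMκ, hAM⟩ := exists_isKappaModel hT hκi hA hcard (hqA 1)
  obtain ⟨N, j, hN, hj, hjκ, hVN⟩ := hκ M hMκ
  have hM := hMκ.isTransitive
  have hVM : V ⊆ M := hVA.trans hAM
  have hfix := map_eq_self hM hN hVM hj.2 ⟨_, hAM (hqA 2)⟩ rfl
  refine ⟨M, N, j, hM, hN, hVM, fun i => hAM (hpA i), hVN, hfix, fun W C hC hW => ?_⟩
  -- Since `κ < κ + ω`, the choice of `θ` gives both `V_{κ+1} ⊆ N` and `κ ∈ j κ`.
  refine vonNeumann_mem_map_levels hM hN hVM (.trans ?_ hVN) (isSuccLimit_ord hκi.aleph0_lt.le)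
    hfix (K := ⟨_, hMκ.mem⟩) rfl (hjκ ?_) (U := ⟨V, hAM (hqA 0)⟩) rfl hC hW
  · refine ZFSet.vonNeumann_subset_of_le (add_le_add_right ?_ _)
    exact Ordinal.one_lt_omega0.le
  · simp [Ordinal.omega0_pos]

theorem IsStronglyUnfoldableTo.isTotallyIndescribable {T : setLang.Theory} (hT : T ⊆ ZFC)
    {κ : Cardinal.{u}} (hκ : IsStronglyUnfoldableTo T κ (κ.ord + Ordinal.omega0)) :
    IsTotallyIndescribable κ := by
  intro m R σ hR hσ
  by_contra! hcon
  obtain ⟨M, N, j, hM, hN, hVM, hpM, hVN, hfix, hj⟩ :=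
    hκ.exists_embedding hT ![levels (Set.univ : Set (Set.Iio κ.ord)), R] (by
      intro i
      fin_cases i
      exacts [levels_subset _, hR])
  let W : Elems M := ⟨_, hpM 0⟩
  let R' : Elems M := ⟨R, hpM 1⟩
  have hVW := hj W Set.univ .univ rfl
  let v : Elems N := ⟨_, hN.mem_trans hVW (j W).2⟩
  have key := UDef.map (n := 2) (P := fun A z => ∀ v : Elems A, v.1 ∈ (z 0).1 →
    ¬ Sat σ A m v (z 1) v) (.all (.imp (.mem 2 0) ((UDef.sat σ m).subst ![2, 1, 2]).not))
    hM hN j ![W, R'] (by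
      intro v hv
      obtain ⟨γ, -, hγ⟩ := mem_levels.1 (show v.1 ∈ levels Set.univ from hv)
      change ¬ Sat σ M m v R' v
      rw [sat_iff_of_lt (isSuccLimit_ord hκ.1.aleph0_lt.le) hM hVM σ m γ.2 hγ.symm, ← hγ]
      exact hcon γ.1 γ.2)
  -- The iterated power sets of `V_κ` computed in `N` are the true ones, so `N` sees `σ` hold over
  -- `V_κ ∈ j W`. It remains to check that `j R` agrees with `R` on `V_κ`.
  refine key v hVW ((sat_iff_of_lt (Ordinal.isSuccLimit_add _ Ordinal.isSuccLimit_omega0) hN hVN σ m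
    (lt_add_of_pos_right _ Ordinal.omega0_pos) rfl).2 ?_)
  convert hσ
  change (j R').1 ∩ ZFSet.vonNeumann κ.ord = R
  have hVN' : ZFSet.vonNeumann κ.ord ⊆ N :=
    (ZFSet.vonNeumann_subset_of_le le_self_add).trans hVN
  have hiff {x : ZFSet.{u}} (hx : x ∈ ZFSet.vonNeumann κ.ord) : x ∈ (j R').1 ↔ x ∈ R := by
    have := mem_map_iff (j := j) hM hN ⟨x, hVM hx⟩ R'
    rwa [hfix ⟨x, hVM hx⟩ hx] at this
  ext x
  rw [ZFSet.mem_inter]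
  exact ⟨fun h => (hiff h.2).1 h.1, fun h => ⟨(hiff (hR h)).2 h, hR h⟩⟩

/-- The cardinals below a limit cardinal form a club. -/
theorem isClub_cardinals {κ : Cardinal.{u}} (hκ : Order.IsSuccLimit κ) :
    IsClub {x : Set.Iio κ.ord | ∃ γ : Cardinal.{u}, γ.ord = x} := by
  refine ⟨fun t ht _ _ a ha => ⟨a.1.card, (ord_card_le _).antisymm ?_⟩, fun x => ?_⟩
  · have hb : (a.1.card).ord < κ.ord := (ord_card_le _).trans_lt a.2
    refine ha.2 (show (⟨_, hb⟩ : Set.Iio κ.ord) ∈ upperBounds t from fun y hy => ?_)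
    obtain ⟨γ, hγ⟩ := ht hy
    have : y.1 ≤ a.1 := ha.1 hy
    change y.1 ≤ _
    rw [← hγ] at this ⊢
    simpa using Ordinal.card_le_card this
  · have hx : x.1.card < κ := lt_ord.1 x.2
    refine ⟨⟨(Order.succ x.1.card).ord, ord_lt_ord.2 (hκ.succ_lt hx)⟩, ⟨_, rfl⟩, ?_⟩
    exact (lt_ord.2 (Order.lt_succ _)).le

instance countable_setPredLang_symbols : Countable setPredLang.Symbols := by
  have h1 (n : ℕ) : Countable (setPredLang.Functions n) := inferInstanceAs (Countable Empty)
  have h2 (n : ℕ) : Subsingleton (setPredLang.Relations n) := ⟨by rintro ⟨⟩ ⟨⟩ <;> rfl⟩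
  exact inferInstanceAs (Countable ((Σ n, setPredLang.Functions n) ⊕ Σ n, setPredLang.Relations n))

theorem IsStronglyUnfoldableTo.isStationary {T : setLang.Theory} (hT : T ⊆ ZFC)
    {κ : Cardinal.{u}} (hκ : IsStronglyUnfoldableTo T κ (κ.ord + Ordinal.omega0)) :
    IsStationary {x : Set.Iio κ.ord |
      ∃ γ : Cardinal.{u}, γ.ord = x ∧ IsTotallyIndescribable γ} := by
  by_contra hstat
  obtain ⟨C₀, hC₀, hdisj⟩ := not_isStationary_iff.1 hstat
  have hκi := hκ.1
  have hlim : Order.IsSuccLimit κ.ord := isSuccLimit_ord hκi.aleph0_lt.le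
  have hcof : Order.cof (Set.Iio κ.ord) ≠ ℵ₀ := by
    rw [Ordinal.cof_Iio, ← Ordinal.lift_cof, hκi.isRegular.cof_ord]
    simpa using hκi.aleph0_lt.ne'
  let C := C₀ ∩ {x : Set.Iio κ.ord | ∃ γ : Cardinal.{u}, γ.ord = x}
  have hC : IsClub C := hC₀.inter hcof (isClub_cardinals hκi.isSuccLimit)
  -- Coding `(m, σ)` by a natural number places the code in `V_κ`, where `j` is the identity.
  obtain ⟨decode, hdecode⟩ := exists_surjective_nat (ℕ × setPredLang.Sentence)
  have hfail (γ : Set.Iio κ.ord) (hγ : γ ∈ C) : ∃ (i : ℕ) (R : ZFSet.{u}),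
      R ⊆ ZFSet.vonNeumann γ.1 ∧
      PredSat (ZFSet.vonNeumann (γ.1 + (decode i).1)) R (decode i).2 ∧
      ∀ α < γ.1, ¬ PredSat (ZFSet.vonNeumann (α + (decode i).1))
        (R ∩ ZFSet.vonNeumann α) (decode i).2 := by
    obtain ⟨hγ₀, c, hc⟩ := hγ
    have hnot : ¬ IsTotallyIndescribable c := fun h =>
      Set.disjoint_left.1 hdisj ⟨c, hc, h⟩ hγ₀
    simp only [IsTotallyIndescribable, hc, not_forall] at hnot
    obtain ⟨m, R, σ, hR, hσ, h⟩ := hnot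
    obtain ⟨i, hi⟩ := hdecode (m, σ)
    refine ⟨i, R, hR, ?_, ?_⟩
    · rwa [hi]
    · rw [hi]
      exact fun α hα hs => h ⟨α, hα, hs⟩
  choose! i R hR hsat hnsat using hfail
  have hVlt {γ : Set.Iio κ.ord} : ZFSet.vonNeumann γ.1 ∈ ZFSet.vonNeumann κ.ord :=
    ZFSet.vonNeumann_mem_of_lt γ.2
  have hnat (k : ℕ) : (k : Ordinal.{u}).toZFSet ∈ ZFSet.vonNeumann κ.ord := by
    rw [ZFSet.mem_vonNeumann, Ordinal.rank_toZFSet]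
    exact (Ordinal.natCast_lt_omega0 k).trans_le (Ordinal.omega0_le_of_isSuccLimit hlim)
  have hω : Ordinal.omega0.toZFSet ∈ ZFSet.vonNeumann κ.ord := by
    rw [ZFSet.mem_vonNeumann, Ordinal.rank_toZFSet, ← ord_aleph0]
    exact ord_lt_ord.2 hκi.aleph0_lt
  have hRV {γ : Set.Iio κ.ord} (hγ : γ ∈ C) : R γ ∈ ZFSet.vonNeumann κ.ord :=
    ZFSet.mem_vonNeumann_of_subset (hR γ hγ) hVlt
  let E : ZFSet.{u} := ZFSet.range fun γ : C =>
    ZFSet.pair (i γ.1 : Ordinal.{u}).toZFSet (ZFSet.pair (ZFSet.vonNeumann γ.1.1) (R γ.1))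
  have hE (e : ZFSet.{u}) : e ∈ E ↔ ∃ γ ∈ C, ZFSet.pair (i γ : Ordinal.{u}).toZFSet
      (ZFSet.pair (ZFSet.vonNeumann γ.1) (R γ)) = e := by simp [E]
  have hpairV {γ : Set.Iio κ.ord} (hγ : γ ∈ C) :
      ZFSet.pair (ZFSet.vonNeumann γ.1) (R γ) ∈ ZFSet.vonNeumann κ.ord :=
    pair_mem_vonNeumann hlim hVlt (hRV hγ)
  have hEV : E ⊆ ZFSet.vonNeumann κ.ord := by
    intro e he
    obtain ⟨γ, hγ, rfl⟩ := (hE e).1 he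
    exact pair_mem_vonNeumann hlim (hnat _) (hpairV hγ)
  obtain ⟨M, N, j, hM, hN, hVM, hpM, hVN, hfix, hj⟩ :=
    hκ.exists_embedding hT ![levels (Set.univ : Set (Set.Iio κ.ord)), levels C, E] (by
      intro i
      fin_cases i
      exacts [levels_subset _, levels_subset _, hEV])
  let W : Elems M := ⟨_, hpM 0⟩
  let D : Elems M := ⟨_, hpM 1⟩
  let E' : Elems M := ⟨E, hpM 2⟩
  let w : Elems M := ⟨_, hVM hω⟩
  have hVD := hj D C hC rfl
  have hcover := UDef.map (n := 3) (P := fun A z => ∀ v : Elems A, v.1 ∈ (z 0).1 →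
    ∃ k : Elems A, k.1 ∈ (z 1).1 ∧ ∃ r p e : Elems A, p.1 = ZFSet.pair v.1 r.1 ∧
      e.1 = ZFSet.pair k.1 p.1 ∧ e.1 ∈ (z 2).1)
    (.all (.imp (.mem 3 0) (.ex (.and (.mem 4 1) (.ex (.ex (.ex (.and (.eq_pair 6 3 5)
      (.and (.eq_pair 7 4 6) (.mem 7 2))))))))))
    hM hN j ![D, w, E'] (by
      intro v hv
      obtain ⟨γ, hγ, hv⟩ := mem_levels.1 (show v.1 ∈ levels C from hv)
      refine ⟨⟨_, hVM (hnat (i γ))⟩, ?_, ⟨_, hVM (hRV hγ)⟩, ⟨_, hVM (hpairV hγ)⟩,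
        ⟨_, hVM (hEV ((hE _).2 ⟨γ, hγ, rfl⟩))⟩, ?_, rfl, (hE _).2 ⟨γ, hγ, rfl⟩⟩
      · exact Ordinal.toZFSet_mem_toZFSet_iff.2 (Ordinal.natCast_lt_omega0 _)
      · rw [← hv])
  let V : Elems N := ⟨_, hN.mem_trans hVD (j D).2⟩
  obtain ⟨k, hk, r, p, e, hp, he, heE⟩ := hcover V hVD
  change k.1 ∈ (j w).1 at hk
  rw [hfix w hω] at hk
  -- As `j ω = ω`, the code of the counterexample at `V_κ` is a true natural number, so its sentence
  -- can be built into the formula transferred next.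
  obtain ⟨k', hk', hkk'⟩ := Ordinal.mem_toZFSet_iff.1 hk
  obtain ⟨k', rfl⟩ := Ordinal.lt_omega0.1 hk'
  let K : Elems M := ⟨_, hVM (hnat k')⟩
  have hjK : (j K).1 = k.1 := (hfix K (hnat k')).trans hkk'
  have hfails := UDef.map (n := 3) (P := fun A z => ∀ v r p e : Elems A,
    p.1 = ZFSet.pair v.1 r.1 → e.1 = ZFSet.pair (z 0).1 p.1 → e.1 ∈ (z 1).1 →
      r.1 ⊆ v.1 ∧ Sat (decode k').2 A (decode k').1 v r v ∧ ∀ v' : Elems A, v'.1 ∈ (z 2).1 →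
        v'.1 ∈ v.1 → ¬ Sat (decode k').2 A (decode k').1 v' r v')
    (.all (.all (.all (.all (.imp (.eq_pair 5 3 4) (.imp (.eq_pair 6 0 5) (.imp (.mem 6 1)
      (.and (.subset 4 3) (.and ((UDef.sat _ _).subst ![3, 4, 3]) (.all (.imp (.mem 7 2)
        (.imp (.mem 7 3) ((UDef.sat _ _).subst ![7, 4, 7]).not))))))))))))
    hM hN j ![K, E', W] (by
      intro v r p e hp he heE
      obtain ⟨γ, hγ, h⟩ := (hE e.1).1 heE
      change e.1 = ZFSet.pair (k' : Ordinal.{u}).toZFSet p.1 at he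
      rw [he, hp, ZFSet.pair_inj, ZFSet.pair_inj] at h
      obtain ⟨hik, hv, hr⟩ := h
      have hik : i γ = k' := by exact_mod_cast Ordinal.toZFSet_injective hik
      have hrv : r.1 ∩ v.1 = r.1 := by
        rw [← hr, ← hv]
        exact ZFSet.inter_eq_left_of_subset (hR γ hγ)
      refine ⟨hv ▸ hr ▸ hR γ hγ, ?_, fun v' hv' hvv' => ?_⟩
      · rw [sat_iff_of_lt hlim hM hVM _ _ γ.2 hv.symm, hrv, ← hr, ← hik]
        exact hsat γ hγ
      · obtain ⟨δ, -, hδ⟩ := mem_levels.1 (show v'.1 ∈ levels Set.univ from hv')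
        rw [← hδ, ← hv, ZFSet.vonNeumann_mem_vonNeumann_iff] at hvv'
        rw [sat_iff_of_lt hlim hM hVM _ _ δ.2 hδ.symm, ← hδ, ← hr, ← hik]
        exact hnsat γ hγ δ.1 hvv')
  obtain ⟨hrV, hs, hns⟩ := hfails V r p e hp (by rw [he, ← hjK]; rfl) heE
  have hlim' : Order.IsSuccLimit (κ.ord + Ordinal.omega0) :=
    Ordinal.isSuccLimit_add _ Ordinal.isSuccLimit_omega0
  have hκω : κ.ord < κ.ord + Ordinal.omega0 := lt_add_of_pos_right _ Ordinal.omega0_pos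
  rw [sat_iff_of_lt hlim' hN hVN _ _ hκω rfl, ZFSet.inter_eq_left_of_subset hrV] at hs
  -- Total indescribability of `κ` reflects the sentence to some `α < κ`; since `j` fixes `V_α`,
  -- this level lies in `j W` and contradicts `hns`.
  obtain ⟨α, hα, hαs⟩ := hκ.isTotallyIndescribable hT _ _ _ hrV hs
  have hαV : ZFSet.vonNeumann α ∈ ZFSet.vonNeumann κ.ord := ZFSet.vonNeumann_mem_of_lt hα
  let v : Elems M := ⟨_, hVM hαV⟩
  have hv : (j v).1 = ZFSet.vonNeumann α := hfix v hαV
  refine hns (j v) ((mem_map_iff hM hN v W).2 (mem_levels.2 ⟨⟨α, hα⟩, trivial, rfl⟩))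
    (hv ▸ hαV) ?_
  rw [sat_iff_of_lt hlim' hN hVN _ _ (hα.trans hκω) hv, hv]
  exact hαs

end Unfoldable

theorem mainTheorem9 (T : Unfoldable.setLang.Theory) (hT : T ⊆ Unfoldable.ZFC)
    (hfin : T.Finite) (κ : Cardinal.{u}) :
    (Unfoldable.IsStronglyUnfoldable T κ →
      Unfoldable.IsTotallyIndescribable κ ∧
      ∀ β < κ.ord, ∃ γ : Cardinal.{u}, β < γ.ord ∧ γ < κ ∧ Unfoldable.IsTotallyIndescribable γ) ∧
    (Unfoldable.IsStronglyUnfoldableTo T κ (κ.ord + Ordinal.omega0) →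
      IsStationary {x : Set.Iio κ.ord |
        ∃ γ : Cardinal.{u}, γ.ord = x ∧ Unfoldable.IsTotallyIndescribable γ}) := by
  refine ⟨fun h => ⟨(h _).isTotallyIndescribable hT, fun β hβ => ?_⟩, fun h => h.isStationary hT⟩
  have hlim : Order.IsSuccLimit κ.ord := Cardinal.isSuccLimit_ord (h 0).1.aleph0_lt.le
  -- The tail above `β` is a club, so the stationary set meets it.
  have hclub : IsClub {x : Set.Iio κ.ord | β < x.1} := by
    refine ⟨fun t ht ⟨y, hy⟩ _ a ha => show β < a.1 from
      lt_of_lt_of_le (ht hy) (show y.1 ≤ a.1 from ha.1 hy), fun x => ?_⟩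
    refine ⟨⟨Order.succ (max β x.1), hlim.succ_lt (max_lt hβ x.2)⟩, ?_, ?_⟩
    · exact show β < Order.succ (max β x.1) from Order.lt_succ_of_le (le_max_left _ _)
    · exact (le_max_right β x.1).trans (Order.le_succ _)
  obtain ⟨x, ⟨γ, hγ, hγt⟩, hβx⟩ := (h _).isStationary hT hclub
  refine ⟨γ, ?_, ?_, hγt⟩
  · rw [hγ]
    exact hβx
  · rw [← Cardinal.ord_lt_ord, hγ]
    exact x.2
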